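/- Let $p,q\ge 0$ be integers. For $\alpha,\mu\in\mathbb R$ and $\sigma>0$ let $$g(y\mid\alpha,\sigma,\mu)=\frac{2\exp\{\alpha(y-\mu)/\sigma\}}{\sqrt{2\pi\sigma}}\left[\frac{(y-\mu)^2/\sigma}{2+\alpha^2/\sigma}\right]^{1/4}K_{1/2}(u),\qquad u=\sqrt{(2+\alpha^2/\sigma)(y-\mu)^2/\sigma},\qquad y\ne\mu,$$ be the shifted asymmetric Laplace (SAL) density, where $K_\nu(z)=\frac12\int_0^\infty s^{\nu-1}\exp\{-\frac z2(s+s^{-1})\}\,ds$ is the modified Bessel function, and let $g(\mu\mid\alpha,\sigma,\mu)=(2\sigma+\alpha^2)^{-1/2}$, the limit for $y\to\mu$. For $K\ge1$ and $\boldsymbol\vartheta=(\boldsymbol\eta_1,\dots,\boldsymbol\eta_K;(\alpha_k,\sigma_k,\boldsymbol\beta_k)_{k=1}^K)$ with $\boldsymbol\eta_k\in\mathbb R^{q+1}$, $\alpha_k\in\mathbb R$, $\sigma_k>0$, $\boldsymbol\beta_k\in\mathbb R^{p+1}$, the $K$-component SAL mixture-of-experts (SALMoE) density is $$f_K(y\mid\mathbf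 x,\mathbf t;\boldsymbol\vartheta)=\sum_{k=1}^K\frac{\exp(\mathbf t^\top\boldsymbol\eta_k)}{\sum_{l=1}^K\exp(\mathbf t^\top\boldsymbol\eta_l)}\,g(y\mid\alpha_k,\sigma_k,\mathbf x^\top\boldsymbol\beta_k),\qquad y\in\mathbb R,\ \mathbf x\in\mathbb R^{p+1},\ \mathbf t\in\mathbb R^{q+1}.$$ Fix constants $0<\sigma_{\min}<\sigma_{\max}<\infty$ and $A,B,E\in[0,\infty)$, and let $\Theta_c=\Theta_c(K)$ be the set of all such $\boldsymbol\vartheta$ with $\boldsymbol\eta_K=\mathbf 0$ and, for all $k$, $\sigma_{\min}\le\sigma_k\le\sigma_{\max}$, $|\alpha_k|\le A$, $\|\boldsymbol\beta_k\|\le B$ and $\|\boldsymbol\eta_k\|\le E$. Let $(Y_i,\mathbf X_i,\mathbf T_i)$, $i\ge1$, be i.i.d. random vectors with values in $\mathbb R\times\mathbb R^{p+1}\times\mathbb R^{q+1}$ (not necessarily distributed according to one of the models) such that $\mathbb E[Y_1^2+\|\mathbf X_1\|^2+\|\mathbf T_1\|^2]<\infty$. Let $$\rho_K(\boldsymbol\vartheta;y,\mathbf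 x,\mathbf t)=-\log f_K(y\mid\mathbf x,\mathbf t;\boldsymbol\vartheta),\qquad R_K(\boldsymbol\vartheta)=\mathbb E\,\rho_K(\boldsymbol\vartheta;Y_1,\mathbf X_1,\mathbf T_1).$$ 1. For every $K\ge1$: $\Theta_c$ is compact and non-empty; $\rho_K$ is Carathéodory on $\Theta_c$ (measurable in $(y,\mathbf x,\mathbf t)$ for each $\boldsymbol\vartheta\in\Theta_c$, and continuous in $\boldsymbol\vartheta\in\Theta_c$ for each $(y,\mathbf x,\mathbf t)$); $\rho_K(\boldsymbol\vartheta;Y_1,\mathbf X_1,\mathbf T_1)\in L^2$ for each $\boldsymbol\vartheta\in\Theta_c$; there is a measurable function $L$ with $L(Y_1,\mathbf X_1,\mathbf T_1)\in L^2$ and $$|\rho_K(\boldsymbol\vartheta;y,\mathbf x,\mathbf t)-\rho_K(\boldsymbol\vartheta';y,\mathbf x,\mathbf t)|\le L(y,\mathbf x,\mathbf t)\,\|\boldsymbol\vartheta-\boldsymbol\vartheta'\|\qquad\text{for all }\boldsymbol\vartheta,\boldsymbol\vartheta'\in\Theta_c\text{ and all }(y,\mathbf x,\mathbf t),$$ where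 $\|\boldsymbol\vartheta\|$ is the maximum of all $\|\boldsymbol\eta_k\|,|\alpha_k|,|\sigma_k|,\|\boldsymbol\beta_k\|$ (hence the bound also holds for the Euclidean norm of $\boldsymbol\vartheta$); and $R_K$ attains its minimum on $\Theta_c$. 2. Let $\alpha>0$, let $\beta\ge1$ be an integer, let $\mathrm{df}(K)=K(p+q+4)-q-1$, and let $$P_{K,n}=\alpha\,\mathrm{df}(K)\,\frac{\log_+^{(\beta)}(n)}{\sqrt n},\qquad\log_+(x)=\max\{1,\log x\},$$ where $\log_+^{(\beta)}$ is the $\beta$-fold composition of $\log_+$. For $K\in\{1,\dots,K_{\max}\}$ and $n\ge1$ let $\hat{\boldsymbol\vartheta}_{K}$ be a maximiser over $\Theta_c$ of $\ell_K(\boldsymbol\vartheta)=\sum_{i=1}^n\log f_K(Y_i\mid\mathbf X_i,\mathbf T_i;\boldsymbol\vartheta)$, and let $$\mathrm{PanIC}(K)=\mathrm{SWIC}_\beta(K)=-2\,\ell_K(\hat{\boldsymbol\vartheta}_{K})+2nP_{K,n}.$$ Let $K^\star\in\{1,\dots,K_{\max}\}$ be the parsimonious number of components, that is, $\min_{\Theta_c}R_{K^\star}\le\min_{\Theta_c}R_K$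 for all $K\in\{1,\dots,K_{\max}\}$, and $\min_{\Theta_c}R_{K^\star}<\min_{\Theta_c}R_K$ for all $1\le K<K^\star$. Then every $\hat K_n$ that minimises $\mathrm{PanIC}(K)$ over $K\in\{1,\dots,K_{\max}\}$, however ties are broken, satisfies $$\lim_{n\to\infty}\mathbb P(\hat K_n=K^\star)=1.$$ -/

import Mathlib

open MeasureTheory ProbabilityTheory Filter Topology

noncomputable section

namespace SALMoE

/-- One observation `(y, x, t)`: a real response, the expert covariates `x ∈ ℝ^{p+1}` and the
gating covariates `t ∈ ℝ^{q+1}`, with their Euclidean norms. -/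
abbrev Obs (p q : ℕ) : Type :=
  ℝ × EuclideanSpace ℝ (Fin (p + 1)) × EuclideanSpace ℝ (Fin (q + 1))

/-- The ambient space of the parameters `ϑ = (η; θ_1, …, θ_K)` with `θ_k = (α_k, σ_k, β_k)`.
It carries the maximum of the norms of its entries, which is at most the Euclidean norm, so that
a Lipschitz bound for it is also one for the Euclidean norm. -/
abbrev Param (p q K : ℕ) : Type :=
  (Fin K → EuclideanSpace ℝ (Fin (q + 1))) × (Fin K → ℝ × ℝ × EuclideanSpace ℝ (Fin (p + 1)))

section Components

variable {p q K : ℕ}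

/-- The gating parameter `η_k`. -/
def Param.eta (θ : Param p q K) (k : Fin K) : EuclideanSpace ℝ (Fin (q + 1)) := θ.1 k

/-- The skewness parameter `α_k`. -/
def Param.skew (θ : Param p q K) (k : Fin K) : ℝ := (θ.2 k).1

/-- The scale parameter `σ_k`. -/
def Param.scale (θ : Param p q K) (k : Fin K) : ℝ := (θ.2 k).2.1

/-- The regression parameter `β_k`. -/
def Param.coef (θ : Param p q K) (k : Fin K) : EuclideanSpace ℝ (Fin (p + 1)) := (θ.2 k).2.2

end Components

/-- The natural parameter space `Θ`: the last gating vector `η_K` vanishes and all scales are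
positive. -/
def paramSpace (p q K : ℕ) : Set (Param p q K) :=
  {θ | (∀ k : Fin K, (k : ℕ) + 1 = K → θ.eta k = 0) ∧ ∀ k, 0 < θ.scale k}

/-- The compact parameter set `Θ_c`. -/
def compactParamSpace (p q K : ℕ) (σmin σmax A B E : ℝ) : Set (Param p q K) :=
  {θ | θ ∈ paramSpace p q K ∧
    ∀ k, σmin ≤ θ.scale k ∧ θ.scale k ≤ σmax ∧ |θ.skew k| ≤ A ∧ ‖θ.coef k‖ ≤ B ∧ ‖θ.eta k‖ ≤ E}

/-- The modified Bessel function `K_ν(z)`, for `z > 0`, by its integral representation. -/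
def besselK (ν z : ℝ) : ℝ :=
  (1 / 2) * ∫ s in Set.Ioi (0 : ℝ), s ^ (ν - 1) * Real.exp (-(z / 2) * (s + s⁻¹))

/-- The density `g(y | α, σ, μ)` of the shifted asymmetric Laplace distribution. At `y = μ` the
formula has the indeterminate form `0 · ∞` (as `K_{1/2}(u) = √(π / (2u)) e^{-u}` for `u > 0`);
its value there is the limit for `y → μ`, so that `g` is continuous in `y`. -/
def salDensity (α σ μ y : ℝ) : ℝ :=
  if y = μ then 1 / √(2 * σ + α ^ 2)
  else
    2 * Real.exp (α * (y - μ) / σ) / √(2 * Real.pi * σ)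
      * (((y - μ) ^ 2 / σ) / (2 + α ^ 2 / σ)) ^ ((1 / 2 : ℝ) / 2)
      * besselK (1 / 2) (√((2 + α ^ 2 / σ) * (y - μ) ^ 2 / σ))

section Model

variable {p q K : ℕ}

/-- The multinomial logistic gating function `π_k(t | η)`. -/
def gating (θ : Param p q K) (t : EuclideanSpace ℝ (Fin (q + 1))) (k : Fin K) : ℝ :=
  Real.exp (inner ℝ t (θ.eta k)) / ∑ l, Real.exp (inner ℝ t (θ.eta l))

/-- The conditional density `f(y | x, t; ϑ)` of the `K`-component model. -/
def density (θ : Param p q K) (z : Obs p q) : ℝ :=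
  ∑ k, gating θ z.2.2 k * salDensity (θ.skew k) (θ.scale k) (inner ℝ z.2.1 (θ.coef k)) z.1

/-- The per-observation loss: the negative log-likelihood of one observation. -/
def loss (θ : Param p q K) (z : Obs p q) : ℝ := -Real.log (density θ z)

/-- The log-likelihood of the first `n` observations. -/
def logLik (n : ℕ) (z : ℕ → Obs p q) (θ : Param p q K) : ℝ :=
  ∑ i ∈ Finset.range n, Real.log (density θ (z i))

/-- The expected loss of `ϑ` when the observations are distributed as `Z`. -/
def risk {Ω : Type*} [MeasurableSpace Ω] (P : Measure Ω) (Z : Ω → Obs p q) (θ : Param p q K) : ℝ :=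
  ∫ ω, loss θ (Z ω) ∂P

end Model

/-- The smallest expected loss that the `K`-component model reaches on `Θ_c`. -/
def minRisk {p q : ℕ} {Ω : Type*} [MeasurableSpace Ω] (P : Measure Ω) (Z : Ω → Obs p q)
    (σmin σmax A B E : ℝ) (K : ℕ) : ℝ :=
  sInf (risk P Z '' compactParamSpace p q K σmin σmax A B E)

/-- `θ` is a maximum likelihood estimate on `Θ_c` from the first `n` observations. -/
def IsMLE {p q K : ℕ} (σmin σmax A B E : ℝ) (n : ℕ) (z : ℕ → Obs p q) (θ : Param p q K) : Prop :=
  θ ∈ compactParamSpace p q K σmin σmax A B E ∧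
    ∀ θ' ∈ compactParamSpace p q K σmin σmax A B E, logLik n z θ' ≤ logLik n z θ

/-- `f(θ, z)` is Carathéodory on `S`: measurable in `z` and continuous in `θ ∈ S`. -/
def IsCaratheodoryOn {Θ 𝓩 : Type*} [TopologicalSpace Θ] [MeasurableSpace 𝓩]
    (f : Θ → 𝓩 → ℝ) (S : Set Θ) : Prop :=
  (∀ θ ∈ S, Measurable (f θ)) ∧ ∀ z, ContinuousOn (fun θ => f θ z) S

/-- `df(K) = K (p + q + 4) - q - 1`. -/
def df (p q K : ℕ) : ℝ := (K : ℝ) * ((p : ℝ) + q + 4) - q - 1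

/-- `log₊(x) = max {1, log x}`. -/
def logPlus (x : ℝ) : ℝ := max 1 (Real.log x)

/-- The penalty `P_{K,n} = α df(K) log₊^{(β)}(n) / √n`, with the `β`-fold composition of
`log₊`. -/
def penalty (p q : ℕ) (α : ℝ) (β K n : ℕ) : ℝ :=
  α * df p q K * (logPlus^[β] (n : ℝ)) / √(n : ℝ)

/-- The information criterion `-2 ℓ(ϑ) + 2 n P_{K,n}` of a fitted `K`-component model. -/
def panIC {p q K : ℕ} (α : ℝ) (β n : ℕ) (z : ℕ → Obs p q) (θ : Param p q K) : ℝ :=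
  -2 * logLik n z θ + 2 * n * penalty p q α β K n

end SALMoE

end

/-!
The function `K_{1/2}` is elementary: the substitution `s = exp (2 x)` makes its integral a Gaussian
integral in `sinh x` (`besselK_one_half`). The density of the asymmetric Laplace distribution is
therefore an exponential (`salDensity_eq_exp_logSAL`), and the loss is a difference of two
log-sum-exp functions (`loss_eq_log_sum_exp_sub`). As log-sum-exp is `1`-Lipschitz for the maximum
norm, the loss is Lipschitz on `Θ_c` with a constant that grows linearly in the observation
(`exists_abs_loss_sub_le`); second moments of the observations are inherited by this constant. The
regularity of the loss and of the risk follows.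

Consistency rests on a uniform deviation bound: over `Θ_c`, the empirical sums of the loss deviate
from their means by `O(√n)` in probability (`exists_uniform_deviation_bound`). No logarithm may be
lost here, since the penalty exceeds the order `√n` of the deviations only by the factor
`log₊^{(β)}(n)`, which may be an iterated logarithm of any depth. The sums are
symmetrised with an independent copy of the sample
(`lintegral_iSup_centred_sum_le`). Given both samples, what is left is a Rademacher process whose
increments are sub-Gaussian with parameters proportional to the distance, and chaining along nets
of geometrically growing cardinality bounds the mean of its supremum by the `ℓ²` norm of an envelope
(`exists_sum_iSup_signedSum_le`). This norm is `O(√n)` in mean, by the second moments.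

On the event of the deviation bound, the maximised log-likelihood of each model is `-n` times its
minimal risk up to `O(√n)` (`abs_logLik_add_minRisk_le`). A model with excess risk loses a term of
order `n`, against which the penalties are negligible; a larger model without excess risk pays a
penalty that eventually exceeds every multiple of `√n` (`eventually_mul_sqrt_lt_gap`). So only
`Kstar` can be selected.
-/

namespace SALMoE

/-! ### The Bessel function of order one half and the Laplace density -/

theorem integrable_cosh_mul_exp_neg_sinh_sq {b : ℝ} (hb : 0 < b) :
    Integrable (fun x : ℝ => Real.cosh x * Real.exp (-b * Real.sinh x ^ 2)) := by
  have h := (integrableOn_image_iff_integrableOn_abs_deriv_smul (s := Set.univ) (f := Real.sinh)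
    (f' := Real.cosh) MeasurableSet.univ (fun x _ => (Real.hasDerivAt_sinh x).hasDerivWithinAt)
    Real.sinh_injective.injOn (fun w : ℝ => Real.exp (-b * w ^ 2))).1
    (integrable_exp_neg_mul_sq hb).integrableOn
  simpa [abs_of_pos (Real.cosh_pos _)] using h

theorem integral_cosh_mul_exp_neg_sinh_sq (b : ℝ) :
    ∫ x : ℝ, Real.cosh x * Real.exp (-b * Real.sinh x ^ 2) = √(Real.pi / b) := by
  have h := integral_image_eq_integral_abs_deriv_smul (s := Set.univ) (f := Real.sinh)
    (f' := Real.cosh) MeasurableSet.univ (fun x _ => (Real.hasDerivAt_sinh x).hasDerivWithinAt)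
    Real.sinh_injective.injOn (fun w : ℝ => Real.exp (-b * w ^ 2))
  rw [Set.image_univ, Real.sinh_surjective.range_eq, setIntegral_univ, setIntegral_univ,
    integral_gaussian] at h
  simpa [abs_of_pos (Real.cosh_pos _)] using h.symm

/-- The odd part `sinh x` of `exp x` integrates to zero against the even weight. -/
theorem integral_exp_mul_exp_neg_sinh_sq {b : ℝ} (hb : 0 < b) :
    ∫ x : ℝ, Real.exp x * Real.exp (-b * Real.sinh x ^ 2) = √(Real.pi / b) := by
  have hint : Integrable (fun x : ℝ => Real.exp x * Real.exp (-b * Real.sinh x ^ 2)) := by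
    refine ((integrable_cosh_mul_exp_neg_sinh_sq hb).const_mul 2).mono'
      (by fun_prop) (ae_of_all _ fun x => ?_)
    rw [Real.norm_of_nonneg (by positivity), ← mul_assoc]
    gcongr
    rw [Real.cosh_eq]
    linarith [Real.exp_pos (-x)]
  have hneg : ∫ x : ℝ, Real.exp (-x) * Real.exp (-b * Real.sinh x ^ 2)
      = ∫ x : ℝ, Real.exp x * Real.exp (-b * Real.sinh x ^ 2) := by
    rw [← integral_neg_eq_self (fun x : ℝ => Real.exp x * Real.exp (-b * Real.sinh x ^ 2))]
    simp
  have hint' : Integrable (fun x : ℝ => Real.exp (-x) * Real.exp (-b * Real.sinh x ^ 2)) := by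
    simpa using hint.comp_neg
  rw [← integral_cosh_mul_exp_neg_sinh_sq b]
  have hsum := integral_add hint hint'
  rw [hneg] at hsum
  have : ∀ x : ℝ, Real.exp x * Real.exp (-b * Real.sinh x ^ 2)
      + Real.exp (-x) * Real.exp (-b * Real.sinh x ^ 2)
      = 2 * (Real.cosh x * Real.exp (-b * Real.sinh x ^ 2)) := by
    intro x
    rw [Real.cosh_eq]
    ring
  simp_rw [this, integral_const_mul] at hsum
  linarith

/-- The closed form of `K_{1/2}`: the substitution `s = exp (2 x)` turns the exponent into
`-z (1 + 2 sinh² x)`, a Gaussian in `sinh x`. -/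
theorem besselK_one_half {z : ℝ} (hz : 0 < z) :
    besselK (1 / 2) z = √(Real.pi / (2 * z)) * Real.exp (-z) := by
  have h := integral_image_eq_integral_abs_deriv_smul (s := Set.univ)
    (f := fun x : ℝ => Real.exp (2 * x)) (f' := fun x => Real.exp (2 * x) * 2) MeasurableSet.univ
    (fun x _ => by
      simpa using (((hasDerivAt_id x).const_mul 2).exp).hasDerivWithinAt (s := Set.univ))
    (fun x _ y _ hxy => by
      have := Real.exp_injective hxy
      linarith)
    (fun s : ℝ => s ^ ((1 / 2 : ℝ) - 1) * Real.exp (-(z / 2) * (s + s⁻¹)))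
  have himg : (fun x : ℝ => Real.exp (2 * x)) '' Set.univ = Set.Ioi 0 := by
    ext s
    simp only [Set.image_univ, Set.mem_range, Set.mem_Ioi]
    refine ⟨fun ⟨x, hx⟩ => hx ▸ Real.exp_pos _, fun hs => ⟨Real.log s / 2, ?_⟩⟩
    rw [mul_div_cancel₀ _ two_ne_zero, Real.exp_log hs]
  rw [himg, setIntegral_univ] at h
  have hfun : ∀ x : ℝ, |Real.exp (2 * x) * 2| • (Real.exp (2 * x) ^ ((1 / 2 : ℝ) - 1)
      * Real.exp (-(z / 2) * (Real.exp (2 * x) + (Real.exp (2 * x))⁻¹)))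
      = (2 * Real.exp (-z)) * (Real.exp x * Real.exp (-(2 * z) * Real.sinh x ^ 2)) := by
    intro x
    rw [abs_of_pos (by positivity), smul_eq_mul, ← Real.exp_mul, ← Real.exp_neg]
    have e1 : -(z / 2) * (Real.exp (2 * x) + Real.exp (-(2 * x)))
        = -z + -(2 * z) * Real.sinh x ^ 2 := by
      rw [Real.sinh_eq, show 2 * x = x + x by ring, neg_add, Real.exp_add, Real.exp_add]
      have : Real.exp x * Real.exp (-x) = 1 := by rw [← Real.exp_add]; simp
      linear_combination -z * this
    have e2 : Real.exp (2 * x) * Real.exp (2 * x * (1 / 2 - 1)) = Real.exp x := by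
      rw [← Real.exp_add]
      congr 1
      ring
    rw [e1, Real.exp_add]
    linear_combination 2 * Real.exp (-z) * Real.exp (-(2 * z) * Real.sinh x ^ 2) * e2
  simp_rw [hfun, integral_const_mul, integral_exp_mul_exp_neg_sinh_sq (by positivity : 0 < 2 * z)]
    at h
  rw [besselK, h]
  ring

/-- The logarithm of the density of the asymmetric Laplace distribution at distance `d` from its
location. -/
noncomputable def logSAL (α σ d : ℝ) : ℝ :=
  -Real.log (√(2 * σ + α ^ 2)) + (α / σ * d - √(2 * σ + α ^ 2) / σ * |d|)

theorem salDensity_eq_exp_logSAL {σ : ℝ} (hσ : 0 < σ) (α μ y : ℝ) :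
    salDensity α σ μ y = Real.exp (logSAL α σ (y - μ)) := by
  have hr : 0 < 2 * σ + α ^ 2 := by positivity
  have hexp : Real.exp (logSAL α σ (y - μ)) = 1 / √(2 * σ + α ^ 2)
      * (Real.exp (α * (y - μ) / σ) * Real.exp (-(√(2 * σ + α ^ 2) / σ * |y - μ|))) := by
    rw [logSAL, Real.exp_add, sub_eq_add_neg, Real.exp_add, Real.exp_neg (Real.log _),
      Real.exp_log (by positivity), one_div, div_mul_eq_mul_div]
  rw [hexp, salDensity]
  split_ifs with h
  · simp [h]
  · have hd : 0 < |y - μ| := abs_pos.2 (sub_ne_zero.2 h)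
    have hsq : (y - μ) ^ 2 = |y - μ| ^ 2 := (sq_abs _).symm
    have hu : √((2 + α ^ 2 / σ) * (y - μ) ^ 2 / σ) = √(2 * σ + α ^ 2) / σ * |y - μ| := by
      rw [Real.sqrt_eq_iff_mul_self_eq (by positivity) (by positivity), hsq]
      have := Real.mul_self_sqrt hr.le
      field_simp
      linear_combination -this
    have hw : ((y - μ) ^ 2 / σ / (2 + α ^ 2 / σ)) ^ ((1 / 2 : ℝ) / 2)
        = √(|y - μ| / √(2 * σ + α ^ 2)) := by
      rw [show (1 / 2 : ℝ) / 2 = (1 / 2) * (1 / 2) by ring,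
        Real.rpow_mul (by positivity), ← Real.sqrt_eq_rpow, ← Real.sqrt_eq_rpow]
      congr 1
      rw [Real.sqrt_eq_iff_mul_self_eq (by positivity) (by positivity), hsq]
      have := Real.mul_self_sqrt hr.le
      have h0 : √(2 * σ + α ^ 2) ≠ 0 := by positivity
      rw [div_mul_div_comm, this]
      field_simp
    rw [hu, hw, besselK_one_half (by positivity)]
    have key : 2 / √(2 * Real.pi * σ) * √(|y - μ| / √(2 * σ + α ^ 2))
        * √(Real.pi / (2 * (√(2 * σ + α ^ 2) / σ * |y - μ|))) = 1 / √(2 * σ + α ^ 2) := by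
      rw [mul_assoc, ← Real.sqrt_mul (by positivity)]
      have : |y - μ| / √(2 * σ + α ^ 2) * (Real.pi / (2 * (√(2 * σ + α ^ 2) / σ * |y - μ|)))
          = (√(2 * Real.pi * σ) / (2 * √(2 * σ + α ^ 2))) ^ 2 := by
        rw [div_pow, Real.sq_sqrt (by positivity)]
        field_simp
      rw [this, Real.sqrt_sq (by positivity)]
      have h0 : √(2 * σ + α ^ 2) ≠ 0 := by positivity
      have h1 : √(2 * Real.pi * σ) ≠ 0 := by positivity
      field_simp
    rw [← key]
    ring

/-! ### Maxima of Rademacher sums -/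

/-- The sign `±1` encoded by a Boolean. -/
def boolSign (b : Bool) : ℝ := if b then 1 else -1

section Rademacher

variable {ι κ : Type*} [Fintype ι]

/-- The Rademacher sum `∑ ε_k a_k`. -/
noncomputable def signedSum (ε : ι → Bool) (a : ι → ℝ) : ℝ := ∑ k, boolSign (ε k) * a k

theorem signedSum_sub (ε : ι → Bool) (a b : ι → ℝ) :
    signedSum ε (fun k => a k - b k) = signedSum ε a - signedSum ε b := by
  simp [signedSum, mul_sub, Finset.sum_sub_distrib]

theorem abs_signedSum_le (ε : ι → Bool) (a : ι → ℝ) : |signedSum ε a| ≤ ∑ k, |a k| := by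
  refine (Finset.abs_sum_le_sum_abs _ _).trans (Finset.sum_le_sum fun k _ => ?_)
  cases h : ε k <;> simp [boolSign]

theorem sum_exp_signedSum_le [DecidableEq ι] (a : ι → ℝ) :
    ∑ ε : ι → Bool, Real.exp (signedSum ε a)
      ≤ 2 ^ Fintype.card ι * Real.exp ((∑ k, a k ^ 2) / 2) := by
  have h : ∑ ε : ι → Bool, Real.exp (signedSum ε a) = ∏ k, (2 * Real.cosh (a k)) := by
    have hp := Finset.prod_univ_sum (fun _ : ι => (Finset.univ : Finset Bool))
      (fun k b => Real.exp (boolSign b * a k))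
    rw [Fintype.piFinset_univ] at hp
    simp_rw [signedSum, Real.exp_sum]
    rw [← hp]
    refine Finset.prod_congr rfl fun k _ => ?_
    rw [Real.cosh_eq]
    simp [boolSign]
    ring
  rw [h, Finset.prod_mul_distrib, Finset.prod_const, Finset.card_univ, Finset.sum_div,
    Real.exp_sum]
  gcongr with k
  exact Real.cosh_le_exp_half_sq _

/-- The maximum of `N` Rademacher sums of variance at most `s ^ 2` has mean of order
`s * log N`. The optimal order `s * √(log N)` is not needed: along a chain of geometrically
shrinking variances, any power of the logarithm is summable. -/
theorem sum_sup_signedSum_le [DecidableEq ι] (U : Finset κ) (a : κ → ι → ℝ) {s : ℝ} (hs : 0 < s)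
    (ha : ∀ u ∈ U, ∑ k, a u k ^ 2 ≤ s ^ 2) {N : ℕ} (hN : 1 ≤ N) (hU : U.card ≤ N) :
    ∑ ε : ι → Bool, ((U.sup fun u => ‖signedSum ε (a u)‖₊ : NNReal) : ℝ)
      ≤ 2 ^ Fintype.card ι * (s * (Real.log (2 * N) + 2)) := by
  have hN' : (1 : ℝ) ≤ N := by exact_mod_cast hN
  have hc : (0 : ℝ) < 2 * N := by positivity
  have hscale : ∀ ε u, signedSum ε (a u) / s = signedSum ε (fun k => a u k / s) := by
    intro ε u
    simp only [signedSum, Finset.sum_div, mul_div_assoc]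
  have hscale' : ∀ ε u, -(signedSum ε (a u) / s) = signedSum ε (fun k => -(a u k / s)) := by
    intro ε u
    rw [hscale]
    simp [signedSum]
  have hmgf : ∀ u ∈ U, ∑ ε : ι → Bool, (Real.exp (signedSum ε (a u) / s)
      + Real.exp (-(signedSum ε (a u) / s))) ≤ 2 ^ Fintype.card ι * 4 := by
    intro u hu
    have hsq : (∑ k, (a u k / s) ^ 2) / 2 ≤ 1 / 2 := by
      simp_rw [div_pow]
      rw [← Finset.sum_div]
      gcongr
      rw [div_le_one (by positivity)]
      exact ha u hu
    have hexp : Real.exp ((∑ k, (a u k / s) ^ 2) / 2) ≤ 2 := by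
      refine (Real.exp_le_exp.2 hsq).trans ?_
      have h1 : Real.exp (1 / 2) ^ 2 = Real.exp 1 := by
        rw [← Real.exp_nat_mul]
        norm_num
      nlinarith [Real.exp_one_lt_d9, Real.exp_pos (1 / 2)]
    rw [Finset.sum_add_distrib]
    simp_rw [hscale', hscale]
    have h1 := sum_exp_signedSum_le (fun k => a u k / s)
    have h2 := sum_exp_signedSum_le (fun k => -(a u k / s))
    simp_rw [neg_sq] at h2
    have : (0 : ℝ) < 2 ^ Fintype.card ι := by positivity
    nlinarith
  have hpt : ∀ ε : ι → Bool, ((U.sup fun u => ‖signedSum ε (a u)‖₊ : NNReal) : ℝ)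
      ≤ s * (Real.log (2 * N) + (∑ u ∈ U, (Real.exp (signedSum ε (a u) / s)
      + Real.exp (-(signedSum ε (a u) / s)))) / (2 * N)) := by
    intro ε
    rcases U.eq_empty_or_nonempty with rfl | hne
    · have : 0 ≤ Real.log (2 * N) := Real.log_nonneg (by linarith)
      simpa using by positivity
    obtain ⟨u, hu, hsup⟩ := Finset.exists_mem_eq_sup U hne fun u => ‖signedSum ε (a u)‖₊
    rw [hsup, coe_nnnorm, Real.norm_eq_abs]
    have hsingle := Finset.single_le_sum (f := fun u => Real.exp (signedSum ε (a u) / s)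
      + Real.exp (-(signedSum ε (a u) / s))) (fun u _ => by positivity) hu
    -- `x ≤ log c + exp x / c` is the tangent inequality `log t ≤ t - 1` at `t = exp x / c`.
    have hx : |signedSum ε (a u)| / s
        ≤ Real.log (2 * N) + Real.exp (|signedSum ε (a u)| / s) / (2 * N) := by
      have := Real.add_one_le_exp (|signedSum ε (a u)| / s - Real.log (2 * N))
      rw [Real.exp_sub, Real.exp_log hc] at this
      linarith
    have habs : Real.exp (|signedSum ε (a u)| / s)
        ≤ Real.exp (signedSum ε (a u) / s) + Real.exp (-(signedSum ε (a u) / s)) := by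
      rcases abs_cases (signedSum ε (a u)) with ⟨h, _⟩ | ⟨h, _⟩ <;> rw [h]
      · linarith [Real.exp_pos (-(signedSum ε (a u) / s))]
      · rw [neg_div]
        linarith [Real.exp_pos (signedSum ε (a u) / s)]
    rw [div_le_iff₀' hs] at hx
    refine hx.trans ?_
    gcongr
    exact habs.trans hsingle
  refine (Finset.sum_le_sum fun ε _ => hpt ε).trans ?_
  rw [← Finset.mul_sum, Finset.sum_add_distrib, ← Finset.sum_div, Finset.sum_comm]
  have hcard : (Finset.univ : Finset (ι → Bool)).card = 2 ^ Fintype.card ι := by simp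
  rw [Finset.sum_const, hcard, nsmul_eq_mul]
  have hsum := Finset.sum_le_sum hmgf
  rw [Finset.sum_const, nsmul_eq_mul] at hsum
  have hU' : (U.card : ℝ) ≤ N := by exact_mod_cast hU
  have : (∑ u ∈ U, ∑ ε : ι → Bool, (Real.exp (signedSum ε (a u) / s)
      + Real.exp (-(signedSum ε (a u) / s)))) / (2 * N) ≤ 2 ^ Fintype.card ι * 2 := by
    rw [div_le_iff₀ hc]
    refine hsum.trans ?_
    have : (0 : ℝ) < 2 ^ Fintype.card ι := by positivity
    nlinarith
  push_cast
  nlinarith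

end Rademacher

/-! ### Chaining over a bounded subset of a finite-dimensional space -/

section Chaining

variable {V : Type*} [NormedAddCommGroup V] [NormedSpace ℝ V] [FiniteDimensional ℝ V]

/-- A bounded set in a finite-dimensional space has nets of mesh `R / 2 ^ j` whose cardinality
grows at most geometrically: the unit ball is covered by `M` balls of half its radius, and this
is iterated at every scale. -/
theorem exists_geometric_nets {S : Set V} (hS : Bornology.IsBounded S) (hne : S.Nonempty) :
    ∃ (M : ℕ) (R : ℝ) (N : ℕ → Finset V), 1 ≤ M ∧ 0 < R ∧ (∀ j, ∀ u ∈ N j, u ∈ S) ∧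
      (∀ j, (N j).card ≤ M ^ j) ∧ ∀ j, ∀ x ∈ S, ∃ u ∈ N j, ‖x - u‖ ≤ R * (1 / 2) ^ j := by
  classical
  obtain ⟨r, hr, hSr⟩ := hS.subset_closedBall_lt 0 (0 : V)
  obtain ⟨T, -, hTfin, hT⟩ := finite_cover_balls_of_compact
    (isCompact_closedBall (0 : V) 1) (by norm_num : (0 : ℝ) < 1 / 2)
  lift T to Finset V using hTfin
  have hTball : ∀ x : V, ‖x‖ ≤ 1 → ∃ t ∈ T, ‖x - t‖ ≤ 1 / 2 := by
    intro x hx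
    have := hT (mem_closedBall_zero_iff.2 hx)
    simp only [Set.mem_iUnion, Metric.mem_ball, dist_eq_norm] at this
    obtain ⟨t, ht, h⟩ := this
    exact ⟨t, by simpa using ht, h.le⟩
  have hTcard : 1 ≤ T.card := by
    obtain ⟨t, ht, -⟩ := hTball 0 (by simp)
    exact Finset.card_pos.2 ⟨t, ht⟩
  have hnet : ∀ j : ℕ, ∃ N : Finset V, N.card ≤ T.card ^ j ∧
      ∀ x ∈ S, ∃ u ∈ N, ‖x - u‖ ≤ r * (1 / 2) ^ j := by
    intro j
    induction j with
    | zero =>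
      exact ⟨{0}, by simp, fun x hx => ⟨0, by simp, by simpa using hSr hx⟩⟩
    | succ j ih =>
      obtain ⟨N, hcard, hN⟩ := ih
      refine ⟨(N ×ˢ T).image fun w => w.1 + (r * (1 / 2) ^ j) • w.2, ?_, fun x hx => ?_⟩
      · refine Finset.card_image_le.trans ?_
        rw [Finset.card_product, pow_succ]
        gcongr
      · obtain ⟨u, hu, hxu⟩ := hN x hx
        have hpos : 0 < r * (1 / 2 : ℝ) ^ j := by positivity
        obtain ⟨t, ht, hxt⟩ := hTball ((r * (1 / 2 : ℝ) ^ j)⁻¹ • (x - u)) (by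
          rw [norm_smul, Real.norm_of_nonneg (by positivity), inv_mul_le_one₀ hpos]
          exact hxu)
        refine ⟨_, Finset.mem_image_of_mem _ (Finset.mk_mem_product hu ht), ?_⟩
        have : x - (u + (r * (1 / 2 : ℝ) ^ j) • t)
            = (r * (1 / 2 : ℝ) ^ j) • ((r * (1 / 2 : ℝ) ^ j)⁻¹ • (x - u) - t) := by
          rw [smul_sub, smul_inv_smul₀ hpos.ne']
          abel
        simp only
        rw [this, norm_smul, Real.norm_of_nonneg hpos.le, pow_succ, ← mul_assoc]
        gcongr
  choose N' hN'card hN' using hnet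
  obtain ⟨x₀, hx₀⟩ := hne
  -- Every net point close to `S` is replaced by a point of `S`, which doubles the mesh.
  let c : ℕ → V → V := fun j u =>
    if h : ∃ x ∈ S, ‖x - u‖ ≤ r * (1 / 2) ^ j then h.choose else x₀
  refine ⟨T.card, 2 * r, fun j => (N' j).image (c j), hTcard, by positivity, ?_, ?_, ?_⟩
  · intro j u hu
    obtain ⟨v, -, rfl⟩ := Finset.mem_image.1 hu
    simp only [c]
    split_ifs with h
    · exact h.choose_spec.1
    · exact hx₀
  · exact fun j => Finset.card_image_le.trans (hN'card j)
  · intro j x hx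
    obtain ⟨u, hu, hxu⟩ := hN' j x hx
    have h : ∃ x ∈ S, ‖x - u‖ ≤ r * (1 / 2) ^ j := ⟨x, hx, hxu⟩
    refine ⟨c j u, Finset.mem_image_of_mem _ hu, ?_⟩
    have hc : c j u = h.choose := dif_pos h
    rw [hc]
    have h2 := h.choose_spec.2
    rw [norm_sub_rev] at h2
    linarith [norm_sub_le_norm_sub_add_norm_sub x u h.choose]

/-- Chaining: the mean of the supremum over `S` of a Lipschitz family of Rademacher sums is at
most a constant, which depends only on `S`, times a bound `s` for the `ℓ²` norms of the Lipschitz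
constants and of the coefficients. -/
theorem exists_sum_iSup_signedSum_le {S : Set V} (hS : Bornology.IsBounded S)
    (hne : S.Nonempty) :
    ∃ C : ENNReal, C ≠ ⊤ ∧ ∀ (ι : Type) [Fintype ι] [DecidableEq ι] (a : V → ι → ℝ) (ℓ : ι → ℝ)
      (s : ℝ), 0 < s → (∀ u ∈ S, ∀ v ∈ S, ∀ k, |a u k - a v k| ≤ ℓ k * ‖u - v‖) →
      ∑ k, ℓ k ^ 2 ≤ s ^ 2 → (∀ u ∈ S, ∑ k, a u k ^ 2 ≤ s ^ 2) →
      ∑ ε : ι → Bool, ⨆ u : S, ‖signedSum ε (a u)‖ₑ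
        ≤ 2 ^ Fintype.card ι * (C * ENNReal.ofReal s) := by
  classical
  obtain ⟨M, R, N, hM, hR, hNS, hNcard, hN⟩ := exists_geometric_nets hS hne
  have hM' : (1 : ℝ) ≤ M := by exact_mod_cast hM
  have hlogM : 0 ≤ Real.log M := Real.log_nonneg hM'
  -- `c j` bounds the mean of the `j`-th link of the chain, relative to `s`.
  let c : ℕ → ℝ := fun j => 2 * R * (1 / 2) ^ j * (Real.log (2 * (M ^ (2 * j + 1) : ℕ)) + 2)
  have hc0 : ∀ j, 0 ≤ c j := by
    intro j
    have : (1 : ℝ) ≤ (M ^ (2 * j + 1) : ℕ) := by exact_mod_cast Nat.one_le_pow _ _ hM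
    have : 0 ≤ Real.log (2 * (M ^ (2 * j + 1) : ℕ)) := Real.log_nonneg (by linarith)
    positivity
  have hcsum : Summable c := by
    have h1 : Summable fun j : ℕ => (j : ℝ) ^ 1 * (1 / 2 : ℝ) ^ j :=
      summable_pow_mul_geometric_of_norm_lt_one 1 (by norm_num)
    have h2 : Summable fun j : ℕ => (1 / 2 : ℝ) ^ j :=
      summable_geometric_of_lt_one (by norm_num) (by norm_num)
    refine ((h1.mul_left (2 * R * (2 * Real.log M))).add
      (h2.mul_left (2 * R * (Real.log 2 + Real.log M + 2)))).congr fun j => ?_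
    have : (M : ℝ) ≠ 0 := by positivity
    simp only [c]
    push_cast
    rw [Real.log_mul (by norm_num) (by positivity), Real.log_pow]
    push_cast
    ring
  refine ⟨ENNReal.ofReal (Real.log 2 + 2) + ∑' j, ENNReal.ofReal (c j), ?_, ?_⟩
  · rw [← ENNReal.ofReal_tsum_of_nonneg hc0 hcsum]
    finiteness
  intro ι _ _ a ℓ s hs hlip hℓ ha
  let U : ℕ → Finset (V × V) := fun j =>
    ((N j) ×ˢ (N (j + 1))).filter fun w => ‖w.1 - w.2‖ ≤ 2 * R * (1 / 2) ^ j
  let m₀ : (ι → Bool) → NNReal := fun ε => (N 0).sup fun u => ‖signedSum ε (a u)‖₊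
  let m : ℕ → (ι → Bool) → NNReal := fun j ε =>
    (U j).sup fun w => ‖signedSum ε (fun k => a w.1 k - a w.2 k)‖₊
  have hpath : ∀ ε, ∀ u ∈ S, ‖signedSum ε (a u)‖ₑ ≤ m₀ ε + ∑' j, (m j ε : ENNReal) := by
    intro ε u hu
    choose v hv huv using fun j => hN j u hu
    have hstep : ∀ j, ‖signedSum ε (a (v j)) - signedSum ε (a (v (j + 1)))‖ₑ ≤ m j ε := by
      intro j
      have hmem : (v j, v (j + 1)) ∈ U j := by
        simp only [U, Finset.mem_filter, Finset.mem_product]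
        refine ⟨⟨hv j, hv (j + 1)⟩, ?_⟩
        have h1 := huv j
        have h2 := huv (j + 1)
        rw [norm_sub_rev] at h1
        have h3 := norm_sub_le_norm_sub_add_norm_sub (v j) u (v (j + 1))
        have h4 : (0 : ℝ) ≤ R * (1 / 2) ^ j := by positivity
        rw [pow_succ] at h2
        linarith
      rw [← signedSum_sub, enorm_eq_nnnorm, ENNReal.coe_le_coe]
      exact Finset.le_sup (f := fun w : V × V => ‖signedSum ε (fun k => a w.1 k - a w.2 k)‖₊) hmem
    have hfin : ∀ j, ‖signedSum ε (a (v j))‖ₑ ≤ m₀ ε + ∑ i ∈ Finset.range j, (m i ε : ENNReal) := by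
      intro j
      induction j with
      | zero =>
        rw [Finset.range_zero, Finset.sum_empty, add_zero, enorm_eq_nnnorm, ENNReal.coe_le_coe]
        exact Finset.le_sup (f := fun u => ‖signedSum ε (a u)‖₊) (hv 0)
      | succ j ih =>
        rw [Finset.sum_range_succ, ← add_assoc]
        calc ‖signedSum ε (a (v (j + 1)))‖ₑ
            = ‖signedSum ε (a (v j))
              - (signedSum ε (a (v j)) - signedSum ε (a (v (j + 1))))‖ₑ := by
              rw [sub_sub_cancel]
          _ ≤ _ := (enorm_sub_le).trans (add_le_add ih (hstep j))
    have hlim : Tendsto (fun j => signedSum ε (a (v j))) atTop (𝓝 (signedSum ε (a u))) := by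
      rw [tendsto_iff_norm_sub_tendsto_zero]
      have hb : ∀ j, ‖signedSum ε (a (v j)) - signedSum ε (a u)‖
          ≤ (∑ k, |ℓ k|) * (R * (1 / 2) ^ j) := by
        intro j
        rw [← signedSum_sub, Real.norm_eq_abs]
        refine (abs_signedSum_le _ _).trans ?_
        rw [Finset.sum_mul]
        refine Finset.sum_le_sum fun k _ => ?_
        refine (hlip _ (hNS j _ (hv j)) u hu k).trans ?_
        rw [norm_sub_rev]
        exact mul_le_mul (le_abs_self _) (huv j) (norm_nonneg _) (abs_nonneg _)
      refine squeeze_zero (fun _ => norm_nonneg _) hb ?_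
      have := (tendsto_pow_atTop_nhds_zero_of_lt_one (by norm_num : (0 : ℝ) ≤ 1 / 2)
        (by norm_num)).const_mul ((∑ k, |ℓ k|) * R)
      simpa [mul_assoc] using this
    refine le_of_tendsto hlim.enorm (Eventually.of_forall fun j => (hfin j).trans ?_)
    gcongr
    exact ENNReal.sum_le_tsum _
  have hcoe : ∀ (f : (ι → Bool) → NNReal) (b : ℝ), ∑ ε, (f ε : ℝ) ≤ 2 ^ Fintype.card ι * (s * b) →
      0 ≤ b → ∑ ε, (f ε : ENNReal)
        ≤ 2 ^ Fintype.card ι * (ENNReal.ofReal b * ENNReal.ofReal s) := by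
    intro f b h hb
    have h2 : (2 : ENNReal) ^ Fintype.card ι = ENNReal.ofReal (2 ^ Fintype.card ι) := by
      rw [ENNReal.ofReal_pow (by norm_num)]
      simp
    rw [h2, ← ENNReal.ofReal_mul hb, ← ENNReal.ofReal_mul (by positivity), mul_comm b s,
      ← ENNReal.ofNNReal_finsetSum, ← ENNReal.ofReal_coe_nnreal]
    exact ENNReal.ofReal_le_ofReal (by simpa using h)
  have h0 : ∑ ε, (m₀ ε : ENNReal)
      ≤ 2 ^ Fintype.card ι * (ENNReal.ofReal (Real.log 2 + 2) * ENNReal.ofReal s) := by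
    refine hcoe _ _ ?_ (by positivity)
    simpa using sum_sup_signedSum_le (N 0) a hs (fun u hu => ha u (hNS 0 u hu)) le_rfl
      (by simpa using hNcard 0)
  have hj : ∀ j, ∑ ε, (m j ε : ENNReal)
      ≤ 2 ^ Fintype.card ι * (ENNReal.ofReal (c j) * ENNReal.ofReal s) := by
    intro j
    refine hcoe _ _ ?_ (hc0 j)
    have := sum_sup_signedSum_le (U j) (fun w k => a w.1 k - a w.2 k)
      (s := s * (2 * R * (1 / 2) ^ j)) (by positivity) ?_ (N := M ^ (2 * j + 1))
      (Nat.one_le_pow _ _ hM) ?_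
    · refine this.trans (le_of_eq ?_)
      simp only [c]
      ring
    · rintro ⟨u, v⟩ hw
      simp only [U, Finset.mem_filter, Finset.mem_product] at hw
      obtain ⟨⟨hu, hv⟩, huv⟩ := hw
      rw [mul_pow]
      refine le_trans ?_ (mul_le_mul_of_nonneg_right hℓ (sq_nonneg _))
      rw [Finset.sum_mul]
      refine Finset.sum_le_sum fun k _ => ?_
      have h1 := hlip u (hNS _ _ hu) v (hNS _ _ hv) k
      calc (a u k - a v k) ^ 2 = |a u k - a v k| ^ 2 := (sq_abs _).symm
        _ ≤ (ℓ k * ‖u - v‖) ^ 2 := by gcongr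
        _ = ℓ k ^ 2 * ‖u - v‖ ^ 2 := by ring
        _ ≤ ℓ k ^ 2 * (2 * R * (1 / 2) ^ j) ^ 2 := by gcongr
    · refine (Finset.card_filter_le _ _).trans ?_
      rw [Finset.card_product, show 2 * j + 1 = j + (j + 1) by ring, pow_add]
      exact Nat.mul_le_mul (hNcard j) (hNcard (j + 1))
  calc ∑ ε : ι → Bool, ⨆ u : S, ‖signedSum ε (a u)‖ₑ
      ≤ ∑ ε, ((m₀ ε : ENNReal) + ∑' j, (m j ε : ENNReal)) :=
        Finset.sum_le_sum fun ε _ => iSup_le fun u => hpath ε u u.2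
    _ = ∑ ε, (m₀ ε : ENNReal) + ∑' j, ∑ ε, (m j ε : ENNReal) := by
        rw [Finset.sum_add_distrib, Summable.tsum_finsetSum fun _ _ => ENNReal.summable]
    _ ≤ 2 ^ Fintype.card ι * (ENNReal.ofReal (Real.log 2 + 2) * ENNReal.ofReal s)
        + ∑' j, 2 ^ Fintype.card ι * (ENNReal.ofReal (c j) * ENNReal.ofReal s) :=
        add_le_add h0 (ENNReal.tsum_le_tsum hj)
    _ = _ := by
        rw [ENNReal.tsum_mul_left, ENNReal.tsum_mul_right, ← mul_add, ← add_mul]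

end Chaining

/-! ### Symmetrisation and a uniform deviation bound of order `√n` -/

section Symmetrisation

variable {X T : Type*} [MeasurableSpace X] [Countable T] {ι : Type} [Fintype ι]

/-- Exchanging the two copies of an observation in the coordinates where `ε` is `-1` preserves
their joint law. -/
theorem lintegral_iSup_signedSum_eq (ν : Measure X) [IsProbabilityMeasure ν] {h : T → X → ℝ}
    (hm : ∀ t, Measurable (h t)) (ε : ι → Bool) :
    ∫⁻ w, ⨆ t, ‖signedSum ε (fun k => h t (w k).1 - h t (w k).2)‖ₑ
        ∂(Measure.pi fun _ : ι => ν.prod ν)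
      = ∫⁻ w, ⨆ t, ‖∑ k, (h t (w k).1 - h t (w k).2)‖ₑ
        ∂(Measure.pi fun _ : ι => ν.prod ν) := by
  let swap : Bool → X × X → X × X := fun b => if b then id else Prod.swap
  have hswap : MeasurePreserving (fun (w : ι → X × X) k => swap (ε k) (w k))
      (Measure.pi fun _ : ι => ν.prod ν) (Measure.pi fun _ : ι => ν.prod ν) := by
    refine measurePreserving_pi _ _ fun k => ?_
    cases h : ε k
    · simpa [swap] using Measure.measurePreserving_swap
    · simpa [swap] using MeasurePreserving.id _
  rw [← hswap.lintegral_comp (f := fun w : ι → X × X =>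
    ⨆ t, ‖∑ k, (h t (w k).1 - h t (w k).2)‖ₑ)
    (Measurable.iSup fun t => by have := hm t; fun_prop)]
  refine lintegral_congr fun w => iSup_congr fun t => congrArg _ ?_
  refine Finset.sum_congr rfl fun k _ => ?_
  cases hk : ε k <;> simp [swap, boolSign, hk]

/-- Symmetrisation: centred sums are compared with the Rademacher sums of the differences to an
independent copy of the sample. -/
theorem lintegral_iSup_centred_sum_le [DecidableEq ι] (ν : Measure X) [IsProbabilityMeasure ν]
    {h : T → X → ℝ} (hm : ∀ t, Measurable (h t)) (hi : ∀ t, Integrable (h t) ν) :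
    2 ^ Fintype.card ι * ∫⁻ z, ⨆ t, ‖∑ k, (h t (z k) - ∫ x, h t x ∂ν)‖ₑ
        ∂(Measure.pi fun _ : ι => ν)
      ≤ ∫⁻ w, ∑ ε : ι → Bool, ⨆ t, ‖signedSum ε (fun k => h t (w k).1 - h t (w k).2)‖ₑ
        ∂(Measure.pi fun _ : ι => ν.prod ν) := by
  have hms : ∀ ε : ι → Bool, Measurable fun w : ι → X × X =>
      ⨆ t, ‖signedSum ε (fun k => h t (w k).1 - h t (w k).2)‖ₑ := by
    intro ε
    refine Measurable.iSup fun t => ?_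
    have := hm t
    unfold signedSum
    fun_prop
  rw [lintegral_finsetSum _ fun ε _ => hms ε]
  simp_rw [lintegral_iSup_signedSum_eq ν hm]
  rw [Finset.sum_const, Finset.card_univ, Fintype.card_fun, Fintype.card_bool, nsmul_eq_mul]
  push_cast
  gcongr
  have hmain : Measurable fun w : (ι → X) × (ι → X) =>
      ⨆ t, ‖∑ k, (h t (w.1 k) - h t (w.2 k))‖ₑ :=
    Measurable.iSup fun t => by have := hm t; fun_prop
  have hprod := (measurePreserving_arrowProdEquivProdArrow X X ι (fun _ => ν)
    (fun _ => ν)).lintegral_comp hmain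
  refine le_trans ?_ hprod.symm.le
  rw [lintegral_prod _ hmain.aemeasurable]
  refine lintegral_mono fun z => iSup_le fun t => ?_
  have hint : ∀ k : ι, Integrable (fun z' : ι → X => h t (z k) - h t (z' k))
      (Measure.pi fun _ : ι => ν) := fun k =>
    (integrable_const _).sub (integrable_comp_eval (μ := fun _ : ι => ν) (hi t))
  have heq : ∑ k, (h t (z k) - ∫ x, h t x ∂ν)
      = ∫ z', ∑ k, (h t (z k) - h t (z' k)) ∂(Measure.pi fun _ : ι => ν) := by
    rw [integral_finsetSum _ fun k _ => hint k]
    refine Finset.sum_congr rfl fun k _ => ?_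
    rw [integral_sub (integrable_const _) (integrable_comp_eval (μ := fun _ : ι => ν) (hi t)),
      integral_comp_eval (μ := fun _ : ι => ν) (hm t).aestronglyMeasurable]
    simp
  rw [heq]
  exact (enorm_integral_le_lintegral_enorm _).trans
    (lintegral_mono fun z' => le_iSup (fun t => ‖∑ k, (h t (z k) - h t (z' k))‖ₑ) t)

end Symmetrisation

section Deviation

variable {V : Type*} [NormedAddCommGroup V] [NormedSpace ℝ V] [FiniteDimensional ℝ V]
  {X : Type*} [MeasurableSpace X]

/-- A Lipschitz family with square-integrable Lipschitz constant, indexed by a bounded set in a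
finite-dimensional space: the supremum of its centred empirical sums has mean `O(√n)`. -/
theorem exists_lintegral_iSup_centred_sum_le {S : Set V} (hS : Bornology.IsBounded S)
    (hne : S.Nonempty) (ν : Measure X) [IsProbabilityMeasure ν] {h : V → X → ℝ} {L : X → ℝ}
    (hm : ∀ u ∈ S, Measurable (h u)) (hlip : ∀ z, ∀ u ∈ S, ∀ v ∈ S,
      |h u z - h v z| ≤ L z * ‖u - v‖) (hL2 : MemLp L 2 ν) (hh2 : ∀ u ∈ S, MemLp (h u) 2 ν) :
    ∃ C : ENNReal, C ≠ ⊤ ∧ ∀ n : ℕ, 1 ≤ n → ∀ D : Set S, D.Countable →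
      ∫⁻ z, ⨆ u : D, ‖∑ k, (h u (z k) - ∫ x, h u x ∂ν)‖ₑ ∂(Measure.pi fun _ : Fin n => ν)
        ≤ C * ENNReal.ofReal (√n) := by
  obtain ⟨C, hC, hchain⟩ := exists_sum_iSup_signedSum_le hS hne
  obtain ⟨u₀, hu₀⟩ := hne
  obtain ⟨d, hd⟩ := hS.exists_norm_le
  -- An envelope of the family which also dominates its Lipschitz constant.
  let F : X → ℝ := fun z => |h u₀ z| + (2 * d + 1) * |L z|
  let H : X × X → ℝ := fun w => F w.1 + F w.2
  have hd0 : 0 ≤ d := (norm_nonneg _).trans (hd _ hu₀)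
  have hFL : ∀ z, |L z| ≤ F z := fun z => by
    simp only [F]
    nlinarith [abs_nonneg (L z), abs_nonneg (h u₀ z)]
  have hFh : ∀ z, ∀ u ∈ S, |h u z| ≤ F z := by
    intro z u hu
    have h1 := hlip z u hu u₀ hu₀
    have h2 : ‖u - u₀‖ ≤ 2 * d + 1 := by
      linarith [norm_sub_le u u₀, hd u hu, hd u₀ hu₀]
    have h3 : L z * ‖u - u₀‖ ≤ |L z| * (2 * d + 1) :=
      mul_le_mul (le_abs_self _) h2 (norm_nonneg _) (abs_nonneg _)
    have h4 := abs_sub_abs_le_abs_sub (h u z) (h u₀ z)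
    simp only [F]
    linarith
  have hF2 : MemLp F 2 ν := (hh2 u₀ hu₀).norm.add (hL2.norm.const_mul (2 * d + 1))
  have hH2 : MemLp H 2 (ν.prod ν) := (hF2.comp_fst ν).add (hF2.comp_snd ν)
  have hHsq : Integrable (fun w => H w ^ 2) (ν.prod ν) := hH2.integrable_sq
  refine ⟨C * ENNReal.ofReal ((1 + ∫ w, H w ^ 2 ∂(ν.prod ν)) / 2),
    ENNReal.mul_ne_top hC ENNReal.ofReal_ne_top, ?_⟩
  intro n hn D hD
  have : Countable D := hD.to_subtype
  have hn0 : (0 : ℝ) < √n := Real.sqrt_pos.2 (by exact_mod_cast hn)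
  -- By the inequality of the means, `s w` is at least the `ℓ²` norm of the envelope.
  let s : (Fin n → X × X) → ℝ := fun w => (√n + (∑ k, H (w k) ^ 2) / √n) / 2
  have hs : ∀ w, 0 < s w := fun w => by
    have : 0 ≤ ∑ k, H (w k) ^ 2 := Finset.sum_nonneg fun k _ => sq_nonneg _
    positivity
  have hsq : ∀ w, ∑ k, H (w k) ^ 2 ≤ s w ^ 2 := fun w => by
    have h1 : √n * ((∑ k, H (w k) ^ 2) / √n) = ∑ k, H (w k) ^ 2 := by
      field_simp
    simp only [s]
    nlinarith [sq_nonneg (√n - (∑ k, H (w k) ^ 2) / √n)]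
  have hrad : ∀ w : Fin n → X × X, ∑ ε : Fin n → Bool, ⨆ u : D,
      ‖signedSum ε (fun k => h u (w k).1 - h u (w k).2)‖ₑ
        ≤ 2 ^ Fintype.card (Fin n) * (C * ENNReal.ofReal (s w)) := by
    intro w
    refine le_trans (Finset.sum_le_sum fun ε _ => ?_) (hchain (Fin n)
      (fun u k => h u (w k).1 - h u (w k).2) (fun k => H (w k)) (s w) (hs w) ?_ (hsq w) ?_)
    · exact iSup_le fun u => le_iSup (fun u : S =>
        ‖signedSum ε (fun k => h u (w k).1 - h u (w k).2)‖ₑ) u.1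
    · intro u hu v hv k
      have h1 := hlip (w k).1 u hu v hv
      have h2 := hlip (w k).2 u hu v hv
      have h3 := abs_sub (h u (w k).1 - h v (w k).1) (h u (w k).2 - h v (w k).2)
      rw [sub_sub_sub_comm] at h3
      refine h3.trans ?_
      have h4 : L (w k).1 ≤ F (w k).1 := (le_abs_self _).trans (hFL _)
      have h5 : L (w k).2 ≤ F (w k).2 := (le_abs_self _).trans (hFL _)
      simp only [H]
      nlinarith [norm_nonneg (u - v)]
    · intro u hu
      refine le_trans (Finset.sum_le_sum fun k _ => ?_) (hsq w)
      refine sq_le_sq' ?_ ?_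
      · have h1 := neg_abs_le (h u (w k).1)
        have h2 := le_abs_self (h u (w k).2)
        have h3 := hFh (w k).1 u hu
        have h4 := hFh (w k).2 u hu
        simp only [H]
        linarith
      · have h1 := le_abs_self (h u (w k).1)
        have h2 := neg_abs_le (h u (w k).2)
        have h3 := hFh (w k).1 u hu
        have h4 := hFh (w k).2 u hu
        simp only [H]
        linarith
  have hsint : Integrable s (Measure.pi fun _ : Fin n => ν.prod ν) := by
    refine ((integrable_const _).add
      ((integrable_finsetSum _ fun k _ => ?_).div_const _)).div_const _
    exact integrable_comp_eval (μ := fun _ : Fin n => ν.prod ν) hHsq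
  have hsval : ∫ w, s w ∂(Measure.pi fun _ : Fin n => ν.prod ν)
      = (1 + ∫ w, H w ^ 2 ∂(ν.prod ν)) / 2 * √n := by
    have hk : ∀ k : Fin n, Integrable (fun w : Fin n → X × X => H (w k) ^ 2)
        (Measure.pi fun _ : Fin n => ν.prod ν) := fun k =>
      integrable_comp_eval (μ := fun _ : Fin n => ν.prod ν) hHsq
    simp only [s]
    rw [integral_div, integral_add (integrable_const _)
      ((integrable_finsetSum _ fun k _ => hk k).div_const _), integral_div,
      integral_finsetSum _ fun k _ => hk k]
    have hk' : ∀ k : Fin n, ∫ w, H (w k) ^ 2 ∂(Measure.pi fun _ : Fin n => ν.prod ν)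
        = ∫ w, H w ^ 2 ∂(ν.prod ν) := fun k =>
      integral_comp_eval (μ := fun _ : Fin n => ν.prod ν) hHsq.aestronglyMeasurable
    simp only [hk', Finset.sum_const, Finset.card_univ, Fintype.card_fin, nsmul_eq_mul,
      integral_const, probReal_univ, one_smul]
    have h1 : √(n : ℝ) * √(n : ℝ) = n := Real.mul_self_sqrt (by positivity)
    field_simp
    rw [sq, h1]
    ring
  have hsym := (lintegral_iSup_centred_sum_le (ι := Fin n) ν (h := fun u : D => h u)
    (fun u => hm u u.1.2) (fun u => (hh2 u u.1.2).integrable (by norm_num))).trans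
    (lintegral_mono hrad)
  rw [lintegral_const_mul' _ _ (by finiteness)] at hsym
  rw [ENNReal.mul_le_mul_iff_right (by simp) (by finiteness), lintegral_const_mul' _ _ hC,
    ← ofReal_integral_eq_lintegral_ofReal hsint (ae_of_all _ fun w => (hs w).le), hsval,
    ENNReal.ofReal_mul (by positivity), ← mul_assoc] at hsym
  exact hsym

/-- With probability at least `1 - C / t`, the empirical sums of an i.i.d. sample deviate from
their means by at most `t √n`, uniformly over the family. -/
theorem exists_uniform_deviation_bound {S : Set V} (hS : Bornology.IsBounded S)
    (hne : S.Nonempty) {Ω : Type*} [MeasurableSpace Ω] {P : Measure Ω} [IsProbabilityMeasure P]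
    {Z : ℕ → Ω → X} (hZ : ∀ i, Measurable (Z i)) (hindep : iIndepFun Z P)
    (hident : ∀ i, IdentDistrib (Z i) (Z 0) P P) {h : V → X → ℝ} {L : X → ℝ}
    (hm : ∀ u ∈ S, Measurable (h u)) (hL : Measurable L)
    (hlip : ∀ z, ∀ u ∈ S, ∀ v ∈ S, |h u z - h v z| ≤ L z * ‖u - v‖)
    (hL2 : MemLp (fun ω => L (Z 0 ω)) 2 P) (hh2 : ∀ u ∈ S, MemLp (fun ω => h u (Z 0 ω)) 2 P) :
    ∃ C : ENNReal, C ≠ ⊤ ∧ ∀ n : ℕ, 1 ≤ n → ∀ t : ℝ, 0 < t → ∃ G : Set Ω, MeasurableSet G ∧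
      P Gᶜ ≤ C / ENNReal.ofReal t ∧ ∀ ω ∈ G, ∀ u ∈ S,
        |∑ i ∈ Finset.range n, h u (Z i ω) - n * ∫ ω, h u (Z 0 ω) ∂P| ≤ t * √n := by
  let ν := P.map (Z 0)
  have : IsProbabilityMeasure ν := Measure.isProbabilityMeasure_map (hZ 0).aemeasurable
  have hν : ∀ u ∈ S, ∫ x, h u x ∂ν = ∫ ω, h u (Z 0 ω) ∂P := fun u hu =>
    integral_map (hZ 0).aemeasurable (hm u hu).aestronglyMeasurable
  obtain ⟨C, hC, hbound⟩ := exists_lintegral_iSup_centred_sum_le hS hne ν hm hlip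
    ((memLp_map_measure_iff hL.aestronglyMeasurable (hZ 0).aemeasurable).2 hL2)
    (fun u hu => (memLp_map_measure_iff (hm u hu).aestronglyMeasurable
      (hZ 0).aemeasurable).2 (hh2 u hu))
  refine ⟨C, hC, fun n hn t ht => ?_⟩
  obtain ⟨D, hD, hDdense⟩ := TopologicalSpace.exists_countable_dense S
  have : Countable D := hD.to_subtype
  have hn0 : (0 : ℝ) < √n := Real.sqrt_pos.2 (by exact_mod_cast hn)
  let Φ : (Fin n → X) → ENNReal := fun z => ⨆ u : D, ‖∑ k, (h u (z k) - ∫ x, h u x ∂ν)‖ₑ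
  have hΦ : Measurable Φ := Measurable.iSup fun u => by
    have := hm u u.1.2
    fun_prop
  have hZn : Measurable fun ω => fun k : Fin n => Z k ω := by fun_prop
  have hlaw : P.map (fun ω => fun k : Fin n => Z k ω) = Measure.pi fun _ : Fin n => ν := by
    rw [(iIndepFun_iff_map_fun_eq_pi_map fun k : Fin n => (hZ k).aemeasurable).1
      (hindep.precomp Fin.val_injective)]
    congr 1
    ext1 k
    exact (hident k).map_eq
  have hmean : ∫⁻ ω, Φ (fun k => Z k ω) ∂P ≤ C * ENNReal.ofReal (√n) := by
    rw [← lintegral_map hΦ hZn, hlaw]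
    exact hbound n hn D hD
  refine ⟨{ω | Φ (fun k => Z k ω) < ENNReal.ofReal (t * √n)},
    measurableSet_lt (hΦ.comp hZn) measurable_const, ?_, ?_⟩
  · have hcompl : {ω | Φ (fun k => Z k ω) < ENNReal.ofReal (t * √n)}ᶜ
        = {ω | ENNReal.ofReal (t * √n) ≤ Φ (fun k => Z k ω)} := by
      ext ω
      simp
    rw [hcompl]
    refine (meas_ge_le_lintegral_div (hΦ.comp hZn).aemeasurable
      (by simpa using by positivity) ENNReal.ofReal_ne_top).trans ?_
    rw [ENNReal.ofReal_mul ht.le]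
    refine (ENNReal.div_le_div_right hmean _).trans (le_of_eq ?_)
    exact ENNReal.mul_div_mul_right _ _ (by simpa using hn0) ENNReal.ofReal_ne_top
  · intro ω hω u hu
    let f : S → ℝ := fun u => |∑ k : Fin n, (h u (Z k ω) - ∫ x, h u x ∂ν)|
    have hcont_h : ∀ z, Continuous fun u : S => h u z := by
      intro z
      refine (LipschitzWith.of_dist_le_mul (K := Real.toNNReal (L z)) fun u v => ?_).continuous
      rw [Real.dist_eq, Subtype.dist_eq, dist_eq_norm]
      exact (hlip z u u.2 v v.2).trans
        (mul_le_mul_of_nonneg_right (Real.le_coe_toNNReal _) (norm_nonneg _))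
    have hcont_int : Continuous fun u : S => ∫ x, h u x ∂ν := by
      refine continuous_of_dominated (bound := fun x => |h hne.some x|
        + |L x| * (Metric.diam S)) ?_ ?_ ?_ ?_
      · exact fun u => (hm u u.2).aestronglyMeasurable
      · refine fun u => ae_of_all _ fun x => ?_
        have h1 := hlip x u u.2 _ hne.some_mem
        have h2 : ‖(u : V) - hne.some‖ ≤ Metric.diam S := by
          rw [← dist_eq_norm]
          exact Metric.dist_le_diam_of_mem hS u.2 hne.some_mem
        have h3 : L x * ‖(u : V) - hne.some‖ ≤ |L x| * Metric.diam S :=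
          mul_le_mul (le_abs_self _) h2 (norm_nonneg _) (abs_nonneg _)
        have h4 := abs_sub_abs_le_abs_sub (h u x) (h hne.some x)
        rw [Real.norm_eq_abs]
        linarith
      · have e1 : MemLp (h hne.some) 2 ν := (memLp_map_measure_iff
          (hm _ hne.some_mem).aestronglyMeasurable (hZ 0).aemeasurable).2 (hh2 _ hne.some_mem)
        have e2 : MemLp L 2 ν :=
          (memLp_map_measure_iff hL.aestronglyMeasurable (hZ 0).aemeasurable).2 hL2
        exact (e1.integrable (by norm_num)).abs.add
          ((e2.integrable (by norm_num)).abs.mul_const _)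
      · exact ae_of_all _ hcont_h
    have hclosed : IsClosed {u : S | f u ≤ t * √n} := by
      refine isClosed_le (continuous_abs.comp (continuous_finsetSum _ fun k _ => ?_))
        continuous_const
      exact (hcont_h _).sub hcont_int
    have hall : ∀ u : S, f u ≤ t * √n := by
      intro u
      have hsub : D ⊆ {u : S | f u ≤ t * √n} := by
        intro v hv
        have h1 := (le_iSup (fun u : D => ‖∑ k : Fin n, (h u (Z k ω) - ∫ x, h u x ∂ν)‖ₑ)
          ⟨v, hv⟩).trans (le_of_lt hω)
        rw [← ofReal_norm, ENNReal.ofReal_le_ofReal_iff (by positivity)] at h1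
        exact h1
      exact hclosed.closure_subset_iff.2 hsub (hDdense u)
    have hu' := hall ⟨u, hu⟩
    simp only [f, Finset.sum_sub_distrib, Finset.sum_const, Finset.card_univ, Fintype.card_fin,
      nsmul_eq_mul, hν u hu] at hu'
    rwa [Fin.sum_univ_eq_sum_range (fun i => h u (Z i ω)) n] at hu'

end Deviation

/-! ### Regularity of the loss in the parameters -/

theorem abs_log_sum_exp_sub_le {ι : Type*} [Fintype ι] [Nonempty ι] {a b : ι → ℝ} {δ : ℝ}
    (h : ∀ k, |a k - b k| ≤ δ) :
    |Real.log (∑ k, Real.exp (a k)) - Real.log (∑ k, Real.exp (b k))| ≤ δ := by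
  have hpos : ∀ c : ι → ℝ, 0 < ∑ k, Real.exp (c k) := fun c =>
    Finset.sum_pos (fun k _ => Real.exp_pos _) Finset.univ_nonempty
  have key : ∀ a b : ι → ℝ, (∀ k, a k ≤ b k + δ) →
      Real.log (∑ k, Real.exp (a k)) ≤ Real.log (∑ k, Real.exp (b k)) + δ := by
    intro a b h
    rw [← Real.log_exp δ, ← Real.log_mul (hpos b).ne' (Real.exp_pos δ).ne', Finset.sum_mul]
    refine Real.log_le_log (hpos a) (Finset.sum_le_sum fun k _ => ?_)
    rw [← Real.exp_add]
    exact Real.exp_le_exp.2 (h k)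
  rw [abs_sub_le_iff]
  constructor
  · linarith [key a b fun k => by linarith [(abs_sub_le_iff.1 (h k)).1]]
  · linarith [key b a fun k => by linarith [(abs_sub_le_iff.1 (h k)).2]]

theorem abs_log_sub_log_le {c x y : ℝ} (hc : 0 < c) (hx : c ≤ x) (hy : c ≤ y) :
    |Real.log x - Real.log y| ≤ |x - y| / c := by
  have key : ∀ x y : ℝ, c ≤ x → c ≤ y → Real.log x - Real.log y ≤ |x - y| / c := by
    intro x y hx hy
    have hx0 := hc.trans_le hx
    have hy0 := hc.trans_le hy
    rw [← Real.log_div hx0.ne' hy0.ne']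
    calc Real.log (x / y) ≤ x / y - 1 := Real.log_le_sub_one_of_pos (by positivity)
      _ = (x - y) / y := by field_simp
      _ ≤ |x - y| / y := by gcongr; exact le_abs_self _
      _ ≤ |x - y| / c := by gcongr
  rw [abs_sub_le_iff]
  exact ⟨key x y hx hy, abs_sub_comm x y ▸ key y x hy hx⟩

theorem abs_div_sub_div_le {a a' σ σ' m b δ δ' : ℝ} (hm : 0 < m) (hσ : m ≤ σ) (hσ' : m ≤ σ')
    (ha : |a - a'| ≤ δ) (ha' : |a'| ≤ b) (hδ : |σ - σ'| ≤ δ') :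
    |a / σ - a' / σ'| ≤ δ / m + b * δ' / m ^ 2 := by
  have h1 := hm.trans_le hσ
  have h2 := hm.trans_le hσ'
  have hδ0 := (abs_nonneg _).trans ha
  have hδ0' := (abs_nonneg _).trans hδ
  have hb := (abs_nonneg _).trans ha'
  have heq : a / σ - a' / σ' = (a - a') / σ + a' * (σ' - σ) / (σ * σ') := by
    field_simp
    ring
  rw [heq]
  refine (abs_add_le _ _).trans (add_le_add ?_ ?_)
  · rw [abs_div, abs_of_pos h1]
    gcongr
  · rw [abs_div, abs_mul, abs_of_pos (mul_pos h1 h2), abs_sub_comm σ']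
    gcongr
    nlinarith

theorem abs_mul_sub_mul_le (a a' d d' : ℝ) :
    |a * d - a' * d'| ≤ |a - a'| * |d| + |a'| * |d - d'| := by
  rw [show a * d - a' * d' = (a - a') * d + a' * (d - d') by ring, ← abs_mul, ← abs_mul]
  exact abs_add_le _ _

/-- On a box of parameters with scales bounded away from zero, the logarithm of the Laplace
density is Lipschitz in the parameters, with a constant that grows linearly in the distance to the
location, and Lipschitz in that distance. -/
theorem exists_abs_logSAL_sub_le {m M A : ℝ} (hm : 0 < m) (hA : 0 ≤ A) :
    ∃ C : ℝ, 0 ≤ C ∧ ∀ α α' σ σ' d d' δ : ℝ, |α| ≤ A → |α'| ≤ A → m ≤ σ → σ ≤ M → m ≤ σ' →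
      σ' ≤ M → |α - α'| ≤ δ → |σ - σ'| ≤ δ →
      |logSAL α σ d - logSAL α' σ' d'| ≤ C * (1 + |d|) * δ + C * |d - d'| := by
  let c := √(2 * m)
  have hc : 0 < c := Real.sqrt_pos.2 (by positivity)
  let b := √(2 * M + A ^ 2)
  have hb : 0 ≤ b := Real.sqrt_nonneg _
  let ρ := (1 + A) / c
  have hρ : 0 ≤ ρ := by positivity
  refine ⟨ρ / c + (1 / m + A / m ^ 2) + (ρ / m + b / m ^ 2) + (A / m + b / m), by positivity, ?_⟩
  intro α α' σ σ' d d' δ hα hα' hσ hσM hσ' hσM' hdα hdσ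
  have hδ := (abs_nonneg _).trans hdα
  have hσ0 := hm.trans_le hσ
  have hσ0' := hm.trans_le hσ'
  set r := √(2 * σ + α ^ 2) with hr
  set r' := √(2 * σ' + α' ^ 2) with hr'
  have hrc : c ≤ r := Real.sqrt_le_sqrt (by nlinarith [sq_nonneg α])
  have hrc' : c ≤ r' := Real.sqrt_le_sqrt (by nlinarith [sq_nonneg α'])
  have hrb' : |r'| ≤ b := by
    rw [abs_of_nonneg (Real.sqrt_nonneg _)]
    refine Real.sqrt_le_sqrt ?_
    have := sq_le_sq' (by linarith [neg_abs_le α']) ((le_abs_self α').trans hα')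
    linarith
  have hrr : |r - r'| ≤ ρ * δ := by
    have h1 : r * r = 2 * σ + α ^ 2 := Real.mul_self_sqrt (by positivity)
    have h2 : r' * r' = 2 * σ' + α' ^ 2 := Real.mul_self_sqrt (by positivity)
    have h3 : |r - r'| * (r + r') ≤ (2 + 2 * A) * δ := by
      rw [← abs_of_pos (a := r + r') (by linarith), ← abs_mul,
        show (r - r') * (r + r') = 2 * (σ - σ') + (α + α') * (α - α') by linear_combination h1 - h2]
      refine (abs_add_le _ _).trans ?_
      rw [abs_mul, abs_mul, abs_two, add_mul]
      gcongr
      linarith [abs_add_le α α']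
    have h4 : |r - r'| * (2 * c) ≤ (2 + 2 * A) * δ :=
      le_trans (by gcongr; linarith) h3
    rw [div_mul_eq_mul_div, le_div_iff₀ hc]
    linarith
  have hlog : |Real.log r - Real.log r'| ≤ ρ / c * δ := by
    refine (abs_log_sub_log_le hc hrc hrc').trans ?_
    rw [div_mul_eq_mul_div]
    gcongr
  have hqα : |α / σ - α' / σ'| ≤ (1 / m + A / m ^ 2) * δ :=
    (abs_div_sub_div_le hm hσ hσ' hdα hα' hdσ).trans (le_of_eq (by ring))
  have hqr : |r / σ - r' / σ'| ≤ (ρ / m + b / m ^ 2) * δ :=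
    (abs_div_sub_div_le hm hσ hσ' hrr hrb' hdσ).trans (le_of_eq (by ring))
  have hα0 : |α' / σ'| ≤ A / m := by
    rw [abs_div, abs_of_pos hσ0']
    gcongr
  have hr0 : |r' / σ'| ≤ b / m := by
    rw [abs_div, abs_of_pos hσ0']
    gcongr
  have h1 := abs_mul_sub_mul_le (α / σ) (α' / σ') d d'
  have h2 := abs_mul_sub_mul_le (r / σ) (r' / σ') |d| |d'|
  rw [abs_abs] at h2
  have h3 : |α / σ - α' / σ'| * |d| ≤ (1 / m + A / m ^ 2) * δ * |d| := by gcongr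
  have h4 : |r / σ - r' / σ'| * |d| ≤ (ρ / m + b / m ^ 2) * δ * |d| := by gcongr
  have h5 : |α' / σ'| * |d - d'| ≤ A / m * |d - d'| := by gcongr
  have h6 : |r' / σ'| * |(|d| - |d'|)| ≤ b / m * |d - d'| :=
    mul_le_mul hr0 (abs_abs_sub_abs_le d d') (abs_nonneg _) ((abs_nonneg _).trans hr0)
  have h7 : |logSAL α σ d - logSAL α' σ' d'| ≤ |Real.log r - Real.log r'|
      + |α / σ * d - α' / σ' * d'| + |r / σ * (|d|) - r' / σ' * (|d'|)| := by
    have heq : logSAL α σ d - logSAL α' σ' d' = -(Real.log r - Real.log r')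
        + (α / σ * d - α' / σ' * d') - (r / σ * |d| - r' / σ' * |d'|) := by
      simp only [logSAL, ← hr, ← hr']
      ring
    rw [heq]
    refine (abs_sub _ _).trans ?_
    gcongr
    refine (abs_add_le _ _).trans ?_
    rw [abs_neg]
  have n1 : 0 ≤ ρ / c * (|d| * δ) := by positivity
  have n2 : 0 ≤ (1 / m + A / m ^ 2) * δ := by positivity
  have n3 : 0 ≤ (ρ / m + b / m ^ 2) * δ := by positivity
  have n4 : 0 ≤ (A / m + b / m) * ((1 + |d|) * δ) := by positivity
  have n5 : 0 ≤ (ρ / c + (1 / m + A / m ^ 2) + (ρ / m + b / m ^ 2)) * |d - d'| := by positivity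
  nlinarith

section Loss

variable {p q K : ℕ}

theorem density_eq_div {θ : Param p q K} (hθ : ∀ k, 0 < θ.scale k) (z : Obs p q) :
    density θ z = (∑ k, Real.exp (inner ℝ z.2.2 (θ.eta k)
      + logSAL (θ.skew k) (θ.scale k) (z.1 - inner ℝ z.2.1 (θ.coef k))))
      / ∑ k, Real.exp (inner ℝ z.2.2 (θ.eta k)) := by
  rw [density, Finset.sum_div]
  refine Finset.sum_congr rfl fun k _ => ?_
  rw [gating, salDensity_eq_exp_logSAL (hθ k), Real.exp_add, div_mul_eq_mul_div]

/-- The loss is a difference of two log-sum-exp functions. -/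
theorem loss_eq_log_sum_exp_sub [Nonempty (Fin K)] {θ : Param p q K} (hθ : ∀ k, 0 < θ.scale k)
    (z : Obs p q) :
    loss θ z = Real.log (∑ k, Real.exp (inner ℝ z.2.2 (θ.eta k)))
      - Real.log (∑ k, Real.exp (inner ℝ z.2.2 (θ.eta k)
        + logSAL (θ.skew k) (θ.scale k) (z.1 - inner ℝ z.2.1 (θ.coef k)))) := by
  have hpos : ∀ c : Fin K → ℝ, ∑ k, Real.exp (c k) ≠ 0 := fun c =>
    (Finset.sum_pos (fun k _ => Real.exp_pos _) Finset.univ_nonempty).ne'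
  rw [loss, density_eq_div hθ, Real.log_div (hpos _) (hpos _)]
  ring

theorem measurable_loss [Nonempty (Fin K)] {θ : Param p q K} (hθ : ∀ k, 0 < θ.scale k) :
    Measurable (loss θ) := by
  have : loss θ = fun z => _ := funext (loss_eq_log_sum_exp_sub hθ)
  rw [this]
  unfold logSAL
  have h1 : ∀ k, Measurable fun z : Obs p q => (inner ℝ z.2.2 (θ.eta k) : ℝ) := fun k =>
    Continuous.measurable (by fun_prop)
  have h2 : ∀ k, Measurable fun z : Obs p q => (inner ℝ z.2.1 (θ.coef k) : ℝ) := fun k =>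
    Continuous.measurable (by fun_prop)
  have h3 : ∀ k, Measurable fun z : Obs p q => |z.1 - inner ℝ z.2.1 (θ.coef k)| := fun k =>
    Continuous.measurable (by fun_prop)
  fun_prop

theorem norm_eta_sub_le (θ θ' : Param p q K) (k : Fin K) :
    ‖θ.eta k - θ'.eta k‖ ≤ ‖θ - θ'‖ :=
  (norm_le_pi_norm (θ - θ').1 k).trans (norm_fst_le _)

theorem abs_skew_sub_le (θ θ' : Param p q K) (k : Fin K) :
    |θ.skew k - θ'.skew k| ≤ ‖θ - θ'‖ :=
  (norm_fst_le ((θ - θ').2 k)).trans ((norm_le_pi_norm (θ - θ').2 k).trans (norm_snd_le _))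

theorem abs_scale_sub_le (θ θ' : Param p q K) (k : Fin K) :
    |θ.scale k - θ'.scale k| ≤ ‖θ - θ'‖ :=
  ((norm_fst_le ((θ - θ').2 k).2).trans (norm_snd_le ((θ - θ').2 k))).trans
    ((norm_le_pi_norm (θ - θ').2 k).trans (norm_snd_le _))

theorem norm_coef_sub_le (θ θ' : Param p q K) (k : Fin K) :
    ‖θ.coef k - θ'.coef k‖ ≤ ‖θ - θ'‖ :=
  ((norm_snd_le ((θ - θ').2 k).2).trans (norm_snd_le ((θ - θ').2 k))).trans
    ((norm_le_pi_norm (θ - θ').2 k).trans (norm_snd_le _))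

variable {σmin σmax A B E : ℝ}

theorem scale_pos {θ : Param p q K} (hθ : θ ∈ compactParamSpace p q K σmin σmax A B E)
    (k : Fin K) : 0 < θ.scale k :=
  hθ.1.2 k

/-- The Lipschitz constant of the loss of one observation grows at most linearly in the
observation, so that it inherits its second moment. -/
theorem exists_abs_loss_sub_le [Nonempty (Fin K)] (hσmin : 0 < σmin) (hA : 0 ≤ A) :
    ∃ C : ℝ, ∀ z : Obs p q, ∀ θ ∈ compactParamSpace p q K σmin σmax A B E,
      ∀ θ' ∈ compactParamSpace p q K σmin σmax A B E,
        |loss θ z - loss θ' z|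
          ≤ (2 * ‖z.2.2‖ + C * (1 + ‖z.1‖ + (B + 1) * ‖z.2.1‖)) * ‖θ - θ'‖ := by
  obtain ⟨C, hC, hlip⟩ := exists_abs_logSAL_sub_le hσmin hA (M := σmax)
  refine ⟨C, fun z θ hθ θ' hθ' => ?_⟩
  rw [loss_eq_log_sum_exp_sub (scale_pos hθ), loss_eq_log_sum_exp_sub (scale_pos hθ')]
  set δ := ‖θ - θ'‖
  have hδ : 0 ≤ δ := norm_nonneg _
  have hgate : ∀ k, |(inner ℝ z.2.2 (θ.eta k) : ℝ) - inner ℝ z.2.2 (θ'.eta k)|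
      ≤ ‖z.2.2‖ * δ := by
    intro k
    rw [← inner_sub_right]
    exact (abs_real_inner_le_norm _ _).trans
      (mul_le_mul_of_nonneg_left (norm_eta_sub_le θ θ' k) (norm_nonneg _))
  have hsal : ∀ k, |logSAL (θ.skew k) (θ.scale k) (z.1 - inner ℝ z.2.1 (θ.coef k))
      - logSAL (θ'.skew k) (θ'.scale k) (z.1 - inner ℝ z.2.1 (θ'.coef k))|
      ≤ C * (1 + ‖z.1‖ + (B + 1) * ‖z.2.1‖) * δ := by
    intro k
    obtain ⟨h1, h2, h3, h4, -⟩ := hθ.2 k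
    obtain ⟨h1', h2', h3', -, -⟩ := hθ'.2 k
    refine (hlip _ _ _ _ (z.1 - inner ℝ z.2.1 (θ.coef k)) (z.1 - inner ℝ z.2.1 (θ'.coef k)) δ
      h3 h3' h1 h2 h1' h2' (abs_skew_sub_le θ θ' k) (abs_scale_sub_le θ θ' k)).trans ?_
    have hd : |z.1 - inner ℝ z.2.1 (θ.coef k)| ≤ ‖z.1‖ + B * ‖z.2.1‖ := by
      refine (abs_sub _ _).trans ?_
      have := abs_real_inner_le_norm z.2.1 (θ.coef k)
      rw [Real.norm_eq_abs]
      nlinarith [norm_nonneg z.2.1]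
    have hdd : |(z.1 - inner ℝ z.2.1 (θ.coef k)) - (z.1 - inner ℝ z.2.1 (θ'.coef k))|
        ≤ ‖z.2.1‖ * δ := by
      rw [sub_sub_sub_cancel_left, ← inner_sub_right]
      refine (abs_real_inner_le_norm _ _).trans ?_
      rw [norm_sub_rev]
      exact mul_le_mul_of_nonneg_left (norm_coef_sub_le θ θ' k) (norm_nonneg _)
    have e1 : C * (1 + |z.1 - inner ℝ z.2.1 (θ.coef k)|) * δ
        ≤ C * (1 + (‖z.1‖ + B * ‖z.2.1‖)) * δ := by gcongr
    have e2 := mul_le_mul_of_nonneg_left hdd hC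
    linarith
  have h1 := abs_log_sum_exp_sub_le hgate
  have h2 := abs_log_sum_exp_sub_le
    (a := fun k => inner ℝ z.2.2 (θ.eta k)
      + logSAL (θ.skew k) (θ.scale k) (z.1 - inner ℝ z.2.1 (θ.coef k)))
    (b := fun k => inner ℝ z.2.2 (θ'.eta k)
      + logSAL (θ'.skew k) (θ'.scale k) (z.1 - inner ℝ z.2.1 (θ'.coef k)))
    (δ := ‖z.2.2‖ * δ + C * (1 + ‖z.1‖ + (B + 1) * ‖z.2.1‖) * δ) (fun k => by
      rw [add_sub_add_comm]
      exact (abs_add_le _ _).trans (add_le_add (hgate k) (hsal k)))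
  rw [sub_sub_sub_comm]
  refine (abs_sub _ _).trans ((add_le_add h1 h2).trans (le_of_eq ?_))
  ring

/-- The parameter with vanishing gating, skewness and regression entries and scale `σ`. -/
def basePoint (p q K : ℕ) (σ : ℝ) : Param p q K := (fun _ => 0, fun _ => (0, σ, 0))

theorem basePoint_mem (hσmin : 0 < σmin) (hσ : σmin ≤ σmax) (hA : 0 ≤ A) (hB : 0 ≤ B)
    (hE : 0 ≤ E) : basePoint p q K σmin ∈ compactParamSpace p q K σmin σmax A B E := by
  simp [basePoint, compactParamSpace, paramSpace, Param.eta, Param.scale, Param.skew, Param.coef,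
    hσmin, hσ, hA, hB, hE]

theorem loss_basePoint [Nonempty (Fin K)] {σ : ℝ} (hσ : 0 < σ) (z : Obs p q) :
    loss (basePoint p q K σ) z = -logSAL 0 σ z.1 := by
  rw [loss_eq_log_sum_exp_sub fun k => by simpa [basePoint, Param.scale] using hσ]
  have hK : (K : ℝ) ≠ 0 := by
    have := Fin.pos_iff_nonempty.2 ‹Nonempty (Fin K)›
    positivity
  simp [basePoint, Param.eta, Param.scale, Param.skew, Param.coef]
  rw [Real.log_mul hK (Real.exp_pos _).ne', Real.log_exp]
  ring

theorem isCompact_compactParamSpace (hσmin : 0 < σmin) :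
    IsCompact (compactParamSpace p q K σmin σmax A B E) := by
  have heq : compactParamSpace p q K σmin σmax A B E = {θ | ∀ k : Fin K,
      ((k : ℕ) + 1 = K → θ.1 k = 0) ∧ σmin ≤ (θ.2 k).2.1 ∧ (θ.2 k).2.1 ≤ σmax ∧
        |(θ.2 k).1| ≤ A ∧ ‖(θ.2 k).2.2‖ ≤ B ∧ ‖θ.1 k‖ ≤ E} := by
    ext θ
    constructor
    · exact fun h k => ⟨h.1.1 k, h.2 k⟩
    · exact fun h => ⟨⟨fun k => (h k).1, fun k => hσmin.trans_le (h k).2.1⟩, fun k => (h k).2⟩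
  rw [heq]
  refine Metric.isCompact_of_isClosed_isBounded ?_ ?_
  · simp only [Set.ofPred_forall]
    refine isClosed_iInter fun k => ?_
    refine IsClosed.and ?_ ?_
    · by_cases hk : (k : ℕ) + 1 = K
      · simpa only [hk, true_imp_iff] using isClosed_eq (by fun_prop) continuous_const
      · simp [hk]
    refine IsClosed.and (isClosed_le (by fun_prop) (by fun_prop)) ?_
    refine IsClosed.and (isClosed_le (by fun_prop) (by fun_prop)) ?_
    refine IsClosed.and (isClosed_le (by fun_prop) (by fun_prop)) ?_
    exact IsClosed.and (isClosed_le (by fun_prop) (by fun_prop))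
      (isClosed_le (by fun_prop) (by fun_prop))
  · refine isBounded_iff_forall_norm_le.2 ⟨|σmax| + |A| + |B| + |E|, fun θ hθ => ?_⟩
    have a1 := abs_nonneg σmax
    have a2 := abs_nonneg A
    have a3 := abs_nonneg B
    have a4 := abs_nonneg E
    rw [Prod.norm_def, sup_le_iff, pi_norm_le_iff_of_nonneg (by positivity),
      pi_norm_le_iff_of_nonneg (by positivity)]
    refine ⟨fun k => ?_, fun k => ?_⟩
    · linarith [(hθ k).2.2.2.2.2, le_abs_self E]
    · obtain ⟨-, h1, h2, h3, h4, -⟩ := hθ k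
      rw [Prod.norm_def, sup_le_iff, Prod.norm_def, sup_le_iff]
      refine ⟨?_, ?_, ?_⟩
      · rw [Real.norm_eq_abs]
        linarith [le_abs_self A]
      · rw [Real.norm_eq_abs, abs_of_pos (hσmin.trans_le h1)]
        linarith [le_abs_self σmax]
      · linarith [le_abs_self B]

end Loss

section Regularity

variable {p q K : ℕ} {σmin σmax A B E : ℝ}

theorem continuousOn_loss [Nonempty (Fin K)] (hσmin : 0 < σmin) (hA : 0 ≤ A) (z : Obs p q) :
    ContinuousOn (fun θ : Param p q K => loss θ z)
      (compactParamSpace p q K σmin σmax A B E) := by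
  obtain ⟨C, hC⟩ := exists_abs_loss_sub_le (p := p) (q := q) (K := K) (σmax := σmax) (B := B)
    (E := E) hσmin hA
  refine (LipschitzOnWith.of_dist_le_mul (K := Real.toNNReal
    (2 * ‖z.2.2‖ + C * (1 + ‖z.1‖ + (B + 1) * ‖z.2.1‖))) fun θ hθ θ' hθ' => ?_).continuousOn
  rw [Real.dist_eq, dist_eq_norm]
  exact (hC z θ hθ θ' hθ').trans
    (mul_le_mul_of_nonneg_right (Real.le_coe_toNNReal _) (norm_nonneg _))

variable {Ω : Type*} [MeasurableSpace Ω] {P : Measure Ω} [IsProbabilityMeasure P]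
  {Z : Ω → Obs p q}

theorem exists_memLp_lipschitz_loss [Nonempty (Fin K)] (hσmin : 0 < σmin) (hA : 0 ≤ A)
    (hY : MemLp (fun ω => (Z ω).1) 2 P) (hX : MemLp (fun ω => (Z ω).2.1) 2 P)
    (hT : MemLp (fun ω => (Z ω).2.2) 2 P) :
    ∃ L : Obs p q → ℝ, Measurable L ∧ MemLp (fun ω => L (Z ω)) 2 P ∧
      ∀ z, ∀ θ ∈ compactParamSpace p q K σmin σmax A B E,
        ∀ θ' ∈ compactParamSpace p q K σmin σmax A B E,
          |loss θ z - loss θ' z| ≤ L z * ‖θ - θ'‖ := by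
  obtain ⟨C, hC⟩ := exists_abs_loss_sub_le (p := p) (q := q) (K := K) (σmax := σmax) (B := B)
    (E := E) hσmin hA
  refine ⟨fun z => 2 * ‖z.2.2‖ + C * (1 + ‖z.1‖ + (B + 1) * ‖z.2.1‖), by fun_prop, ?_, hC⟩
  have h1 := hX.norm.const_mul (B + 1)
  have h2 := (((memLp_const (1 : ℝ)).add hY.norm).add h1).const_mul C
  exact (hT.norm.const_mul 2).add h2

theorem memLp_loss [Nonempty (Fin K)] (hσmin : 0 < σmin) (hσ : σmin ≤ σmax) (hA : 0 ≤ A)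
    (hB : 0 ≤ B) (hE : 0 ≤ E) (hZ : Measurable Z)
    (hY : MemLp (fun ω => (Z ω).1) 2 P) (hX : MemLp (fun ω => (Z ω).2.1) 2 P)
    (hT : MemLp (fun ω => (Z ω).2.2) 2 P) {θ : Param p q K}
    (hθ : θ ∈ compactParamSpace p q K σmin σmax A B E) :
    MemLp (fun ω => loss θ (Z ω)) 2 P := by
  obtain ⟨L, -, hL2, hlip⟩ := exists_memLp_lipschitz_loss (P := P) (K := K) (σmax := σmax)
    (B := B) (E := E) hσmin hA hY hX hT
  have hbase := basePoint_mem (p := p) (q := q) (K := K) hσmin hσ hA hB hE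
  have h0 : MemLp (fun ω => loss (basePoint p q K σmin) (Z ω)) 2 P := by
    have h1 := (hY.norm.const_mul (√(2 * σmin + 0 ^ 2) / σmin)).neg
    have h2 := ((memLp_const (-Real.log √(2 * σmin + 0 ^ 2))).add h1).neg
    refine h2.congr_norm ((measurable_loss (scale_pos hbase)).comp hZ).aestronglyMeasurable
      (ae_of_all _ fun ω => ?_)
    simp [loss_basePoint hσmin, logSAL]
  have h1 : MemLp (fun ω => loss θ (Z ω) - loss (basePoint p q K σmin) (Z ω)) 2 P := by
    refine (hL2.mul_const ‖θ - basePoint p q K σmin‖).mono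
      (((measurable_loss (scale_pos hθ)).comp hZ).sub
        ((measurable_loss (scale_pos hbase)).comp hZ)).aestronglyMeasurable
      (ae_of_all _ fun ω => ?_)
    exact (hlip (Z ω) θ hθ _ hbase).trans (le_abs_self _)
  exact (h1.add h0).ae_eq (ae_of_all _ fun ω => by simp)

theorem exists_isMinOn_risk [Nonempty (Fin K)] (hσmin : 0 < σmin) (hσ : σmin ≤ σmax) (hA : 0 ≤ A)
    (hB : 0 ≤ B) (hE : 0 ≤ E) (hZ : Measurable Z)
    (hY : MemLp (fun ω => (Z ω).1) 2 P) (hX : MemLp (fun ω => (Z ω).2.1) 2 P)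
    (hT : MemLp (fun ω => (Z ω).2.2) 2 P) :
    ∃ θ ∈ compactParamSpace p q K σmin σmax A B E,
      IsMinOn (risk P Z) (compactParamSpace p q K σmin σmax A B E) θ := by
  obtain ⟨L, -, hL2, hlip⟩ := exists_memLp_lipschitz_loss (P := P) (K := K) (σmax := σmax)
    (B := B) (E := E) hσmin hA hY hX hT
  have hint : ∀ θ ∈ compactParamSpace p q K σmin σmax A B E,
      Integrable (fun ω => loss θ (Z ω)) P := fun θ hθ =>
    (memLp_loss hσmin hσ hA hB hE hZ hY hX hT hθ).integrable (by norm_num)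
  have hLint : Integrable (fun ω => L (Z ω)) P := hL2.integrable (by norm_num)
  refine (isCompact_compactParamSpace hσmin).exists_isMinOn
    ⟨_, basePoint_mem hσmin hσ hA hB hE⟩ ?_
  refine (LipschitzOnWith.of_dist_le_mul (K := Real.toNNReal (∫ ω, L (Z ω) ∂P))
    fun θ hθ θ' hθ' => ?_).continuousOn
  rw [dist_eq_norm, dist_eq_norm, risk, risk, ← integral_sub (hint θ hθ) (hint θ' hθ')]
  refine (norm_integral_le_of_norm_le (hLint.mul_const ‖θ - θ'‖)
    (ae_of_all _ fun ω => hlip (Z ω) θ hθ θ' hθ')).trans ?_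
  rw [integral_mul_const]
  exact mul_le_mul_of_nonneg_right (Real.le_coe_toNNReal _) (norm_nonneg _)

end Regularity

/-! ### The penalty -/

theorem tendsto_iterate_logPlus_atTop (β : ℕ) : Tendsto logPlus^[β] atTop atTop :=
  Tendsto.iterate (tendsto_atTop_mono (fun _ => le_max_right _ _) Real.tendsto_log_atTop) β

theorem one_le_iterate_logPlus {β : ℕ} (hβ : 1 ≤ β) (x : ℝ) : 1 ≤ logPlus^[β] x := by
  obtain ⟨m, rfl⟩ := Nat.exists_eq_add_of_le' hβ
  rw [Function.iterate_succ_apply']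
  exact le_max_left _ _

theorem iterate_logPlus_le {β : ℕ} (hβ : 1 ≤ β) (x : ℝ) : logPlus^[β] x ≤ logPlus x := by
  induction β, hβ using Nat.le_induction with
  | base => simp
  | succ β hβ ih =>
    rw [Function.iterate_succ_apply']
    refine le_trans ?_ ih
    have h1 := one_le_iterate_logPlus hβ x
    exact max_le h1 ((Real.log_le_sub_one_of_pos (by linarith)).trans (by linarith))

theorem eventually_iterate_logPlus_le_mul_sqrt {β : ℕ} (hβ : 1 ≤ β) {c : ℝ} (hc : 0 < c) :
    ∀ᶠ n : ℕ in atTop, logPlus^[β] (n : ℝ) ≤ c * √(n : ℝ) := by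
  have h1 : ∀ᶠ x : ℝ in atTop, logPlus^[β] x ≤ c * √x := by
    have h2 := (isLittleO_log_rpow_atTop (by norm_num : (0 : ℝ) < 1 / 2)).bound hc
    filter_upwards [h2, Real.tendsto_log_atTop.eventually_ge_atTop 1] with x hx hlog
    refine (iterate_logPlus_le hβ x).trans ?_
    rw [logPlus, max_eq_right hlog]
    rw [← Real.sqrt_eq_rpow, Real.norm_of_nonneg (by linarith),
      Real.norm_of_nonneg (Real.sqrt_nonneg _)] at hx
    exact hx
  exact tendsto_natCast_atTop_atTop.eventually h1

theorem nat_mul_penalty (p q : ℕ) (α : ℝ) (β K n : ℕ) :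
    n * penalty p q α β K n = √(n : ℝ) * (α * df p q K * logPlus^[β] (n : ℝ)) := by
  rw [penalty, mul_div_assoc', mul_comm (n : ℝ), mul_div_assoc, Real.div_sqrt, mul_comm]

/-- Deviations of order `√n` are eventually dominated by the gap of the criteria of two models:
an excess risk contributes a term of order `n`, against which the penalties are negligible, and
without an excess risk the larger model pays a penalty of order larger than `√n`. -/
theorem eventually_mul_sqrt_lt_gap (p q : ℕ) {α : ℝ} (hα : 0 < α) {β : ℕ} (hβ : 1 ≤ β)
    {K Kstar : ℕ} (hne : K ≠ Kstar) {m mstar : ℝ} (hle : mstar ≤ m) (hlt : K < Kstar → mstar < m)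
    (t : ℝ) :
    ∀ᶠ n : ℕ in atTop, t * √(n : ℝ) < n * (m - mstar)
      + (n * penalty p q α β K n - n * penalty p q α β Kstar n) := by
  have hsqrt : Tendsto (fun n : ℕ => √(n : ℝ)) atTop atTop :=
    Real.tendsto_sqrt_atTop.comp tendsto_natCast_atTop_atTop
  have hc : (0 : ℝ) < α * (p + q + 4) := by positivity
  have hgap : ∀ n : ℕ, n * (m - mstar)
      + (n * penalty p q α β K n - n * penalty p q α β Kstar n)
      = (√(n : ℝ) * (m - mstar)
        + α * (p + q + 4) * (K - Kstar) * logPlus^[β] (n : ℝ)) * √(n : ℝ) := by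
    intro n
    have h1 : √(n : ℝ) * √(n : ℝ) = n := Real.mul_self_sqrt (by positivity)
    rw [nat_mul_penalty, nat_mul_penalty, df, df]
    linear_combination (mstar - m) * h1
  simp_rw [hgap]
  suffices h : ∀ᶠ n : ℕ in atTop, t < √(n : ℝ) * (m - mstar)
      + α * (p + q + 4) * (K - Kstar) * logPlus^[β] (n : ℝ) by
    filter_upwards [h, hsqrt.eventually_gt_atTop 0] with n hn hpos
    exact mul_lt_mul_of_pos_right hn hpos
  rcases lt_or_gt_of_ne hne with hK | hK
  · have hδ := sub_pos.2 (hlt hK)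
    have hK' : (0 : ℝ) < Kstar - K := sub_pos.2 (by exact_mod_cast hK)
    set b := α * (p + q + 4) * (Kstar - K) with hb
    have hb0 : 0 < b := by positivity
    filter_upwards [eventually_iterate_logPlus_le_mul_sqrt hβ
      (c := (m - mstar) / (2 * b)) (by positivity),
      (hsqrt.const_mul_atTop (half_pos hδ)).eventually_gt_atTop t] with n h1 h2
    have h3 : b * logPlus^[β] (n : ℝ) ≤ (m - mstar) / 2 * √(n : ℝ) := by
      refine (mul_le_mul_of_nonneg_left h1 hb0.le).trans (le_of_eq ?_)
      field_simp
    have h4 : α * (p + q + 4) * (K - Kstar) * logPlus^[β] (n : ℝ)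
        = -(b * logPlus^[β] (n : ℝ)) := by
      rw [hb]
      ring
    rw [h4]
    linarith
  · have hK' : (0 : ℝ) < K - Kstar := sub_pos.2 (by exact_mod_cast hK)
    have hlog := ((tendsto_iterate_logPlus_atTop β).comp
      tendsto_natCast_atTop_atTop).const_mul_atTop (mul_pos hc hK')
    filter_upwards [hlog.eventually_gt_atTop t] with n hn
    have : 0 ≤ √(n : ℝ) * (m - mstar) := mul_nonneg (Real.sqrt_nonneg _) (by linarith)
    simp only [Function.comp_apply] at hn
    linarith

/-! ### Consistency of the selected number of components -/

section Consistency

variable {p q K : ℕ} {σmin σmax A B E : ℝ} {Ω : Type*} [MeasurableSpace Ω] {P : Measure Ω}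

theorem minRisk_eq_of_isMinOn {Z : Ω → Obs p q} {θ : Param p q K}
    (hθ : θ ∈ compactParamSpace p q K σmin σmax A B E)
    (hmin : IsMinOn (risk P Z) (compactParamSpace p q K σmin σmax A B E) θ) :
    minRisk P Z σmin σmax A B E K = risk P Z θ :=
  IsLeast.csInf_eq ⟨Set.mem_image_of_mem _ hθ, by
    rintro _ ⟨θ', hθ', rfl⟩
    exact hmin hθ'⟩

theorem logLik_eq_neg_sum_loss (n : ℕ) (z : ℕ → Obs p q) (θ : Param p q K) :
    logLik n z θ = -∑ i ∈ Finset.range n, loss θ (z i) := by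
  simp [logLik, loss]

/-- The maximised log-likelihood inherits a uniform deviation bound of the empirical losses. -/
theorem abs_logLik_add_minRisk_le {Z : Ω → Obs p q} {n : ℕ} {z : ℕ → Obs p q}
    {θhat θmin : Param p q K} {b : ℝ} (hhat : IsMLE σmin σmax A B E n z θhat)
    (hθ : θmin ∈ compactParamSpace p q K σmin σmax A B E)
    (hmin : IsMinOn (risk P Z) (compactParamSpace p q K σmin σmax A B E) θmin)
    (hdev : ∀ θ ∈ compactParamSpace p q K σmin σmax A B E,
      |∑ i ∈ Finset.range n, loss θ (z i) - n * risk P Z θ| ≤ b) :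
    |logLik n z θhat + n * minRisk P Z σmin σmax A B E K| ≤ b := by
  rw [minRisk_eq_of_isMinOn hθ hmin, abs_le]
  have h1 := abs_le.1 (hdev θhat hhat.1)
  have h2 := abs_le.1 (hdev θmin hθ)
  have h3 := hhat.2 θmin hθ
  have h4 : (n : ℝ) * risk P Z θmin ≤ n * risk P Z θhat :=
    mul_le_mul_of_nonneg_left (hmin hhat.1) (by positivity)
  rw [logLik_eq_neg_sum_loss] at h3 ⊢
  rw [logLik_eq_neg_sum_loss] at h3
  constructor <;> linarith

/-- Deviations of order `√n` of the maximised log-likelihoods cannot outweigh the gap of the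
criteria. -/
theorem panIC_lt_of_gap {Kstar n : ℕ} {α : ℝ} {β : ℕ} {z : ℕ → Obs p q} {θ : Param p q K}
    {θstar : Param p q Kstar} {m mstar b : ℝ} (h : |logLik n z θ + n * m| ≤ b)
    (hstar : |logLik n z θstar + n * mstar| ≤ b)
    (hgap : 2 * b < n * (m - mstar)
      + (n * penalty p q α β K n - n * penalty p q α β Kstar n)) :
    panIC α β n z θstar < panIC α β n z θ := by
  have h1 := abs_le.1 h
  have h2 := abs_le.1 hstar
  unfold panIC
  linarith

end Consistency

end SALMoE

theorem mainTheorem4 {Ω : Type*} [MeasurableSpace Ω] (P : Measure Ω) [IsProbabilityMeasure P]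
    (p q : ℕ) (σmin σmax A B E : ℝ) (hσmin : 0 < σmin) (hσ : σmin < σmax)
    (hA : 0 ≤ A) (hB : 0 ≤ B) (hE : 0 ≤ E)
    -- the observations `Z i = (Y i, X i, T i)` are i.i.d. with finite second moments
    (Y : ℕ → Ω → ℝ) (X : ℕ → Ω → EuclideanSpace ℝ (Fin (p + 1)))
    (T : ℕ → Ω → EuclideanSpace ℝ (Fin (q + 1))) (Z : ℕ → Ω → SALMoE.Obs p q)
    (hZ : ∀ i ω, Z i ω = (Y i ω, X i ω, T i ω))
    (hmeas : ∀ i, Measurable (Z i)) (hindep : iIndepFun Z P)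
    (hident : ∀ i, IdentDistrib (Z i) (Z 0) P P)
    (hY : MemLp (Y 0) 2 P) (hX : MemLp (X 0) 2 P) (hT : MemLp (T 0) 2 P) :
    -- regularity of the loss, for each fixed number of components
    (∀ K : ℕ, 1 ≤ K →
      IsCompact (SALMoE.compactParamSpace p q K σmin σmax A B E) ∧
      (SALMoE.compactParamSpace p q K σmin σmax A B E).Nonempty ∧
      SALMoE.IsCaratheodoryOn (SALMoE.loss (p := p) (q := q) (K := K))
        (SALMoE.compactParamSpace p q K σmin σmax A B E) ∧
      (∀ θ ∈ SALMoE.compactParamSpace p q K σmin σmax A B E,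
        MemLp (fun ω => SALMoE.loss θ (Z 0 ω)) 2 P) ∧
      (∃ L : SALMoE.Obs p q → ℝ, Measurable L ∧ MemLp (fun ω => L (Z 0 ω)) 2 P ∧
        ∀ z, ∀ θ ∈ SALMoE.compactParamSpace p q K σmin σmax A B E,
          ∀ θ' ∈ SALMoE.compactParamSpace p q K σmin σmax A B E,
            |SALMoE.loss θ z - SALMoE.loss θ' z| ≤ L z * ‖θ - θ'‖) ∧
      (∃ θ ∈ SALMoE.compactParamSpace p q K σmin σmax A B E,
        IsMinOn (SALMoE.risk P (Z 0)) (SALMoE.compactParamSpace p q K σmin σmax A B E) θ)) ∧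
    -- consistency of the selected number of components
    (∀ (α : ℝ) (β Kmax Kstar : ℕ), 0 < α → 1 ≤ β → 1 ≤ Kstar → Kstar ≤ Kmax →
      (∀ K, 1 ≤ K → K ≤ Kmax →
        SALMoE.minRisk P (Z 0) σmin σmax A B E Kstar ≤ SALMoE.minRisk P (Z 0) σmin σmax A B E K) →
      (∀ K, 1 ≤ K → K < Kstar →
        SALMoE.minRisk P (Z 0) σmin σmax A B E Kstar < SALMoE.minRisk P (Z 0) σmin σmax A B E K) →
      ∀ θhat : (K : ℕ) → ℕ → Ω → SALMoE.Param p q K,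
        (∀ K, 1 ≤ K → K ≤ Kmax → ∀ n, 1 ≤ n →
          ∀ᵐ ω ∂P, SALMoE.IsMLE σmin σmax A B E n (fun i => Z i ω) (θhat K n ω)) →
      ∀ Khat : ℕ → Ω → ℕ,
        (∀ n, 1 ≤ n → ∀ᵐ ω ∂P, 1 ≤ Khat n ω ∧ Khat n ω ≤ Kmax ∧
          ∀ K, 1 ≤ K → K ≤ Kmax →
            SALMoE.panIC α β n (fun i => Z i ω) (θhat (Khat n ω) n ω)
              ≤ SALMoE.panIC α β n (fun i => Z i ω) (θhat K n ω)) →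
      Tendsto (fun n => P {ω | Khat n ω = Kstar}) atTop (𝓝 1)) := by
  have hYZ : MemLp (fun ω => (Z 0 ω).1) 2 P := by simpa [hZ] using hY
  have hXZ : MemLp (fun ω => (Z 0 ω).2.1) 2 P := by simpa [hZ] using hX
  have hTZ : MemLp (fun ω => (Z 0 ω).2.2) 2 P := by simpa [hZ] using hT
  refine ⟨fun K hK => ?_, ?_⟩
  · have : Nonempty (Fin K) := Fin.pos_iff_nonempty.1 hK
    exact ⟨SALMoE.isCompact_compactParamSpace hσmin,
      ⟨_, SALMoE.basePoint_mem hσmin hσ.le hA hB hE⟩,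
      ⟨fun θ hθ => SALMoE.measurable_loss (SALMoE.scale_pos hθ),
        SALMoE.continuousOn_loss hσmin hA⟩,
      fun θ hθ => SALMoE.memLp_loss hσmin hσ.le hA hB hE (hmeas 0) hYZ hXZ hTZ hθ,
      SALMoE.exists_memLp_lipschitz_loss hσmin hA hYZ hXZ hTZ,
      SALMoE.exists_isMinOn_risk hσmin hσ.le hA hB hE (hmeas 0) hYZ hXZ hTZ⟩
  intro α β Kmax Kstar hα hβ hKstar hKmax hle hlt θhat hθhat Khat hKhat
  have hdev : ∀ K ∈ Finset.Icc 1 Kmax, ∃ C : ENNReal, C ≠ ⊤ ∧ ∀ n : ℕ, 1 ≤ n → ∀ t : ℝ, 0 < t →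
      ∃ G : Set Ω, MeasurableSet G ∧ P Gᶜ ≤ C / ENNReal.ofReal t ∧ ∀ ω ∈ G,
        ∀ θ ∈ SALMoE.compactParamSpace p q K σmin σmax A B E,
          |∑ i ∈ Finset.range n, SALMoE.loss θ (Z i ω) - n * SALMoE.risk P (Z 0) θ|
            ≤ t * √(n : ℝ) := by
    intro K hK
    have : Nonempty (Fin K) := Fin.pos_iff_nonempty.1 (Finset.mem_Icc.1 hK).1
    obtain ⟨L, hL, hL2, hlip⟩ := SALMoE.exists_memLp_lipschitz_loss (P := P) (K := K)
      (σmax := σmax) (B := B) (E := E) hσmin hA hYZ hXZ hTZ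
    exact SALMoE.exists_uniform_deviation_bound
      (SALMoE.isCompact_compactParamSpace hσmin).isBounded
      ⟨_, SALMoE.basePoint_mem hσmin hσ.le hA hB hE⟩ hmeas hindep hident
      (fun θ hθ => SALMoE.measurable_loss (SALMoE.scale_pos hθ)) hL hlip hL2
      (fun θ hθ => SALMoE.memLp_loss hσmin hσ.le hA hB hE (hmeas 0) hYZ hXZ hTZ hθ)
  choose! C hC hdev using hdev
  set Ctot := ∑ K ∈ Finset.Icc 1 Kmax, C K with hCtot
  have hCtop : Ctot ≠ ⊤ := ENNReal.sum_ne_top.2 hC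
  refine tendsto_order.2 ⟨fun a ha => ?_, fun a ha => Eventually.of_forall fun n =>
    prob_le_one.trans_lt ha⟩
  -- Choose `t` such that all uniform bounds at level `t √n` hold with probability above `a`.
  obtain ⟨t, ht, hta⟩ : ∃ t : ℝ, 0 < t ∧ Ctot / ENNReal.ofReal t < 1 - a := by
    have hlim : Tendsto (fun t : ℝ => Ctot / ENNReal.ofReal t) atTop (𝓝 0) := by
      have := ENNReal.Tendsto.const_div (a := Ctot) ENNReal.tendsto_ofReal_atTop (Or.inr hCtop)
      simpa using this
    obtain ⟨t, ht, hta⟩ := ((eventually_gt_atTop (0 : ℝ)).and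
      (hlim.eventually_lt_const (tsub_pos_of_lt ha))).exists
    exact ⟨t, ht, hta⟩
  have hgap : ∀ᶠ n : ℕ in atTop, ∀ K ∈ Finset.Icc 1 Kmax, K ≠ Kstar →
      2 * t * √(n : ℝ) < n * (SALMoE.minRisk P (Z 0) σmin σmax A B E K
        - SALMoE.minRisk P (Z 0) σmin σmax A B E Kstar)
        + (n * SALMoE.penalty p q α β K n - n * SALMoE.penalty p q α β Kstar n) := by
    refine (Finset.eventually_all _).2 fun K hK => ?_
    by_cases hne : K = Kstar
    · exact Eventually.of_forall fun n h => absurd hne h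
    obtain ⟨h1, h2⟩ := Finset.mem_Icc.1 hK
    filter_upwards [SALMoE.eventually_mul_sqrt_lt_gap p q hα hβ hne (hle K h1 h2) (hlt K h1)
      (2 * t)] with n hn _ using hn
  filter_upwards [hgap, eventually_ge_atTop 1] with n hgap hn
  choose! G hGm hGP hG using fun K hK => hdev K hK n hn t ht
  have hcompl : P (⋃ K ∈ Finset.Icc 1 Kmax, (G K)ᶜ) < 1 - a := by
    refine (measure_biUnion_finset_le _ _).trans_lt (lt_of_le_of_lt ?_ hta)
    rw [hCtot, div_eq_mul_inv, Finset.sum_mul]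
    exact Finset.sum_le_sum fun K hK => hGP K hK
  have hGmeas : MeasurableSet (⋃ K ∈ Finset.Icc 1 Kmax, (G K)ᶜ) :=
    Finset.measurableSet_biUnion _ fun K hK => (hGm K hK).compl
  have hlow : a < P (⋃ K ∈ Finset.Icc 1 Kmax, (G K)ᶜ)ᶜ := by
    rw [prob_compl_eq_one_sub hGmeas]
    exact lt_tsub_comm.1 hcompl
  refine hlow.trans_le (measure_mono_ae ?_)
  have hmle : ∀ᵐ ω ∂P, ∀ K ∈ Finset.Icc 1 Kmax,
      SALMoE.IsMLE σmin σmax A B E n (fun i => Z i ω) (θhat K n ω) :=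
    (Finset.eventually_all _).2 fun K hK =>
      hθhat K (Finset.mem_Icc.1 hK).1 (Finset.mem_Icc.1 hK).2 n hn
  filter_upwards [hmle, hKhat n hn] with ω hmle hKω
  intro (hω : ω ∈ (⋃ K ∈ Finset.Icc 1 Kmax, (G K)ᶜ)ᶜ)
  change Khat n ω = Kstar
  simp only [Set.mem_compl_iff, Set.mem_iUnion, not_exists, not_not] at hω
  obtain ⟨h1, h2, h3⟩ := hKω
  have hbound : ∀ K ∈ Finset.Icc 1 Kmax, |SALMoE.logLik n (fun i => Z i ω) (θhat K n ω)
      + n * SALMoE.minRisk P (Z 0) σmin σmax A B E K| ≤ t * √(n : ℝ) := by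
    intro K hK
    have : Nonempty (Fin K) := Fin.pos_iff_nonempty.1 (Finset.mem_Icc.1 hK).1
    obtain ⟨θmin, hθmin, hmin⟩ := SALMoE.exists_isMinOn_risk (P := P) (K := K) hσmin hσ.le hA hB
      hE (hmeas 0) hYZ hXZ hTZ
    exact SALMoE.abs_logLik_add_minRisk_le (hmle K hK) hθmin hmin (hG K hK ω (hω K hK))
  by_contra hne
  have hmem := Finset.mem_Icc.2 ⟨h1, h2⟩
  have hlt' := SALMoE.panIC_lt_of_gap (hbound _ hmem)
    (hbound Kstar (Finset.mem_Icc.2 ⟨hKstar, hKmax⟩))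
    (by simpa only [mul_assoc] using hgap _ hmem hne)
  exact absurd (h3 Kstar hKstar hKmax) (not_le.2 hlt')
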